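/- **Setting.** Let $n\ge 1$ and let $\Omega\subseteq\mathbb R^n\times\mathbb R^m$ be open. Consider a first order system $$\Delta^s(\mathbf x,\mathbf u,p)=0,\qquad s=1,\dots,m,\qquad p=(p_{\alpha j}),\quad p_{\alpha j}=\partial u_\alpha/\partial x_j ,$$ where $\Delta^s$ is a polynomial in $p$ of bounded degree with coefficients smooth in $(\mathbf x,\mathbf u)\in\Omega$. A jet $(\mathbf x,\mathbf u,p)$ *satisfies the system* if all $\Delta^s$ vanish there. Everything is local near a given point $q_0\in\Omega$. A smooth point transformation $\phi=(Z,W)$ of the variables $(\mathbf x,\mathbf u)$ prolongs, by $D_xW=p'\,D_xZ$ with the total derivatives $D_x=\partial_x+p\,\partial_u$, to the jets with $\det D_xZ\ne0$. *Reduction.* An invertible smooth point transformation $\mathbf z=Z(\mathbf x,\mathbf u)$, $\mathbf w=W(\mathbf x,\mathbf u)$ on an open set $U$ *reduces* the system if there are integers $\overline N_s\ge1$ and polynomials $\widetilde\Delta^s(\mathbf w,p')$, homogeneous of degree $\overline N_s$ in $p'$ with coefficients smooth in $\mathbf w$, such that a jet over $U$ with $\det D_xZ\neq0$ satisfies the given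 system iff its image satisfies $\widetilde\Delta^s(\mathbf w,p')=0$, $s=1,\dots,m$; and if over each point of $U$ some jet with $\det D_xZ\ne0$ satisfies the given system. The reduction is *generic* if the jets over $U$ with $\det D_xZ\neq0$ that satisfy the system are dense among all the jets over $U$ that satisfy it. *Algebra.* On an open set $U$, let $\Xi_1,\dots,\Xi_{n+1}$ be smooth vector fields in the variables $(\mathbf x,\mathbf u)$, linearly independent over $\mathbb R$, such that $\Xi_1,\dots,\Xi_n$ are linearly independent at each point of $U$ (rank $n$), $[\Xi_i,\Xi_j]=0$ and $[\Xi_i,\Xi_{n+1}]=\Xi_i$ for $i,j\le n$, and such that every smooth function on an open subset of $U$ that is invariant under $\Xi_1,\dots,\Xi_n$ is invariant under $\Xi_{n+1}$. A jet over $q\in U$ is *regular* for this algebra if, whenever the element $Y=\Xi_{n+1}-\sum_i c_i\Xi_i$ $(c_i\in\mathbb R)$ vanishes at $q$, the linear part of $Y$ at $q$ annihilates no nonzero vector $(v,pv)$, $v\in\mathbb R^n$. The algebra is *admitted (on the regular jets)* if, for every element $Y$ of its span, each transformation $\phi$ of a local flow of $Y$ on $U$ maps the system to itself: a jet (a regular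 jet) at which the prolongation of $\phi$ is defined satisfies the system iff its image does; and if over each point of $U$ some regular jet satisfies the system. **Theorem 1.** 1. The system is reduced by an invertible point transformation of a neighbourhood of $q_0$ in $\Omega$ if and only if, on some neighbourhood of $q_0$ in $\Omega$, it admits such an algebra on the regular jets. 2. The system is generically reduced by an invertible point transformation of a neighbourhood of $q_0$ in $\Omega$ if and only if, on some neighbourhood $U$ of $q_0$ in $\Omega$, it admits such an algebra (on all jets) for which the regular jets that satisfy the system are dense among the jets over $U$ that satisfy it. 3. If such an algebra is admitted on the regular jets on an open set $U$ with $q_0\in U\subseteq\Omega$, then the system is reduced by a point transformation of a neighbourhood of $q_0$ in $U$ that straightens the algebra: $\Xi_i=\partial/\partial z_i$ for $i\le n$ and $\Xi_{n+1}=\sum_j z_j\,\partial/\partial z_j$ (so that the $w_\alpha$ are invariants of $\Xi_1,\dots,\Xi_{n+1}$). 4. If the system is reduced by an invertible point transformation of an open set $U$ with $q_0\in U\subseteq\Omega$, then such an algebra, straightened in this way by this transformation, is admitted on the regular jets on $U$. -/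

import Mathlib

open scoped ContDiff

/-- The space of the variables `(x, u)`: `n` independent and `m` dependent ones. -/
abbrev Base (n m : ℕ) : Type := (Fin n → ℝ) × (Fin m → ℝ)

/-- The space of first order jets `((x, u), p)`, where `p α j` stands for `∂u_α/∂x_j`. -/
abbrev Jet (n m : ℕ) : Type := Base n m × Matrix (Fin m) (Fin n) ℝ

/-- A system of `m` equations, polynomial in the first order derivatives: equation `s` is a
polynomial in the variables `p_{α j}` whose coefficients depend on `(x, u)`. -/
abbrev PolySystem (n m : ℕ) : Type := Fin m → Base n m → MvPolynomial (Fin m × Fin n) ℝ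

/-- The coefficients are smooth on `Ω`, and the degrees in the derivatives are bounded. -/
def PolySystem.IsSmoothOn {n m : ℕ} (Δ : PolySystem n m) (Ω : Set (Base n m)) : Prop :=
  ∀ s, (∀ d, ContDiffOn ℝ ∞ (fun q => (Δ s q).coeff d) Ω) ∧
    ∃ N : ℕ, ∀ q ∈ Ω, (Δ s q).totalDegree ≤ N

/-- The jet `j` satisfies the system: all the equations vanish there. -/
def PolySystem.HoldsAt {n m : ℕ} (Δ : PolySystem n m) (j : Jet n m) : Prop :=
  ∀ s, MvPolynomial.eval (fun a : Fin m × Fin n => j.2 a.1 a.2) (Δ s j.1) = 0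

/-- The part over `U` of the variety that the system defines in the space of jets. -/
def PolySystem.variety {n m : ℕ} (Δ : PolySystem n m) (U : Set (Base n m)) : Set (Jet n m) :=
  {j | j.1 ∈ U ∧ Δ.HoldsAt j}

/-- The system with coefficients `Q` that depend on the dependent variables only. -/
def autonomousSystem {n m : ℕ} (Q : Fin m → (Fin m → ℝ) → MvPolynomial (Fin m × Fin n) ℝ) :
    PolySystem n m :=
  fun s q => Q s q.2

/-- The matrix of the total derivatives `∂F_a/∂x_j + ∑ α, (∂F_a/∂u_α) p_{α j}` of the components
of `F`. -/
noncomputable def totalDeriv {n m k : ℕ} (F : Base n m → (Fin k → ℝ)) (j : Jet n m) :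
    Matrix (Fin k) (Fin n) ℝ :=
  Matrix.of fun a i => fderiv ℝ F j.1 (Pi.single i 1, fun α => j.2 α i) a

/-- The prolongation of the transformation `φ = (Z, W)` is defined at the jet `j`: the total
Jacobian determinant of the new independent variables `Z` does not vanish there. -/
def ProlongableAt {n m : ℕ} (φ : Base n m → Base n m) (j : Jet n m) : Prop :=
  (totalDeriv (fun q => (φ q).1) j).det ≠ 0

/-- The prolongation of `φ = (Z, W)` to first order jets. By the chain rule, the new derivatives
`p'` satisfy `D_x W = p' * D_x Z`. -/
noncomputable def prolong {n m : ℕ} (φ : Base n m → Base n m) (j : Jet n m) : Jet n m :=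
  (φ j.1, totalDeriv (fun q => (φ q).2) j * (totalDeriv (fun q => (φ q).1) j)⁻¹)

/-- `φ` is a local flow of the vector field `Y` on `U`: it is defined for the times in `(a, b)`
and the initial points in the open set `U₀`, and its trajectories stay in `U`. -/
structure IsLocalFlow {n m : ℕ} (Y : Base n m → Base n m) (U U₀ : Set (Base n m)) (a b : ℝ)
    (φ : ℝ → Base n m → Base n m) : Prop where
  neg : a < 0
  pos : 0 < b
  isOpen : IsOpen U₀
  subset : U₀ ⊆ U
  smooth : ContDiffOn ℝ ∞ (fun r : ℝ × Base n m => φ r.1 r.2) (Set.Ioo a b ×ˢ U₀)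
  zero : ∀ q ∈ U₀, φ 0 q = q
  mem : ∀ t ∈ Set.Ioo a b, ∀ q ∈ U₀, φ t q ∈ U
  deriv : ∀ t ∈ Set.Ioo a b, ∀ q ∈ U₀, HasDerivAt (fun τ => φ τ q) (Y (φ t q)) t

/-- `Y` is (the generator of) a point symmetry of the system, as far as the jets in `R` over `U`
are concerned: the point transformations of the local one-parameter groups that `Y` generates
map the system to itself, wherever their prolongations are defined. -/
def PolySystem.IsSymmetryOn {n m : ℕ} (Δ : PolySystem n m) (U : Set (Base n m))
    (R : Set (Jet n m)) (Y : Base n m → Base n m) : Prop :=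
  ∀ (U₀ : Set (Base n m)) (a b : ℝ) (φ : ℝ → Base n m → Base n m), IsLocalFlow Y U U₀ a b φ →
    ∀ t ∈ Set.Ioo a b, ∀ j ∈ R, j.1 ∈ U₀ → ProlongableAt (φ t) j →
      (Δ.HoldsAt j ↔ Δ.HoldsAt (prolong (φ t) j))

/-- The vector fields `Ξ_1, …, Ξ_n` (`Ξ i.castSucc`) and `Ξ_{n+1}` (`Ξ (Fin.last n)`) on `U` span
an `(n + 1)`-dimensional Lie algebra with the required structure. -/
structure IsReductionAlgebra {n m : ℕ} (U : Set (Base n m))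
    (Ξ : Fin (n + 1) → Base n m → Base n m) : Prop where
  smooth : ∀ k, ContDiffOn ℝ ∞ (Ξ k) U
  /-- the dimension is `n + 1` -/
  linearIndependent : LinearIndependent ℝ fun k => U.domRestrict (Ξ k)
  /-- `Ξ_1, …, Ξ_n` generate a distribution of rank `n` -/
  rank : ∀ q ∈ U, LinearIndependent ℝ fun i : Fin n => Ξ i.castSucc q
  commute : ∀ i j : Fin n, ∀ q ∈ U,
    VectorField.lieBracket ℝ (Ξ i.castSucc) (Ξ j.castSucc) q = 0
  bracket_last : ∀ i : Fin n, ∀ q ∈ U,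
    VectorField.lieBracket ℝ (Ξ i.castSucc) (Ξ (Fin.last n)) q = Ξ i.castSucc q
  /-- the common invariants of `Ξ_1, …, Ξ_n` are invariants of `Ξ_{n+1}` -/
  invariant : ∀ U' ⊆ U, IsOpen U' → ∀ f : Base n m → ℝ, ContDiffOn ℝ ∞ f U' →
    (∀ i : Fin n, ∀ q ∈ U', fderiv ℝ f q (Ξ i.castSucc q) = 0) →
      ∀ q ∈ U', fderiv ℝ f q (Ξ (Fin.last n) q) = 0

/-- The jets that are regular for the algebra. If `Y = Ξ_{n+1} - ∑ i, c i • Ξ_i` is the element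
that vanishes at `q = (x, u)`, its linear part at `q` annihilates no nonzero vector `(v, p v)` of
the contact plane of the jet. In canonical variables, in which `Ξ_i = ∂/∂z_i` and
`Ξ_{n+1} = ∑ z_j ∂/∂z_j`, that linear part is `∑ dz_j ⊗ ∂/∂z_j`, so that the condition says that
the total Jacobian determinant of `z` does not vanish at the jet. -/
def regularJets {n m : ℕ} (Ξ : Fin (n + 1) → Base n m → Base n m) : Set (Jet n m) :=
  {j | ∀ c : Fin n → ℝ, Ξ (Fin.last n) j.1 = ∑ i, c i • Ξ i.castSucc j.1 →
    ∀ v : Fin n → ℝ,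
      fderiv ℝ (fun q => Ξ (Fin.last n) q - ∑ i, c i • Ξ i.castSucc q) j.1 (v, j.2.mulVec v) = 0 →
        v = 0}

/-- The algebra spanned by `Ξ` has the required structure, all its elements are symmetries of the
system on the jets in `R`, and over each point of `U` some jet of the system is regular. -/
structure PolySystem.AdmitsAlgebra {n m : ℕ} (Δ : PolySystem n m) (U : Set (Base n m))
    (R : Set (Jet n m)) (Ξ : Fin (n + 1) → Base n m → Base n m) : Prop where
  algebra : IsReductionAlgebra U Ξ
  symmetry : ∀ c : Fin (n + 1) → ℝ, Δ.IsSymmetryOn U R fun q => ∑ k, c k • Ξ k q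
  regular : ∀ q ∈ U, ∃ p, Δ.HoldsAt (q, p) ∧ (q, p) ∈ regularJets Ξ

/-- An invertible smooth point transformation `(z, w) = (Z(x, u), W(x, u))` between open sets. -/
structure PointTransformation (n m : ℕ) where
  /-- the transformation and its inverse -/
  toHomeo : OpenPartialHomeomorph (Base n m) (Base n m)
  smooth : ContDiffOn ℝ ∞ toHomeo toHomeo.source
  smooth_symm : ContDiffOn ℝ ∞ toHomeo.symm toHomeo.target

/-- `Φ` maps the system to an autonomous system whose equations are homogeneous polynomials of
positive degrees in the derivatives: a jet at which the prolongation is defined satisfies the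
source system iff its image satisfies the target system, and over each point there is some jet of
the source system at which the prolongation is defined. -/
def PolySystem.IsReducedBy {n m : ℕ} (Δ : PolySystem n m) (Φ : PointTransformation n m) : Prop :=
  (∃ (N : Fin m → ℕ) (Q : Fin m → (Fin m → ℝ) → MvPolynomial (Fin m × Fin n) ℝ),
    (∀ s, 1 ≤ N s) ∧
    (∀ s d, ContDiffOn ℝ ∞ (fun w => (Q s w).coeff d) (Prod.snd '' Φ.toHomeo.target)) ∧
    (∀ s, ∀ w ∈ Prod.snd '' Φ.toHomeo.target, (Q s w).IsHomogeneous (N s)) ∧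
    ∀ j : Jet n m, j.1 ∈ Φ.toHomeo.source → ProlongableAt Φ.toHomeo j →
      (Δ.HoldsAt j ↔ (autonomousSystem Q).HoldsAt (prolong Φ.toHomeo j))) ∧
  ∀ q ∈ Φ.toHomeo.source, ∃ p, Δ.HoldsAt (q, p) ∧ ProlongableAt Φ.toHomeo (q, p)

/-- In the variables `(z, w)` given by `Φ`, one has `Ξ_i = ∂/∂z_i` for `i = 1, …, n` and
`Ξ_{n+1} = ∑ z_j ∂/∂z_j`. -/
def PointTransformation.Straightens {n m : ℕ} (Φ : PointTransformation n m)
    (Ξ : Fin (n + 1) → Base n m → Base n m) : Prop :=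
  ∀ q ∈ Φ.toHomeo.source,
    (∀ i : Fin n, fderiv ℝ Φ.toHomeo q (Ξ i.castSucc q) = (Pi.single i 1, 0)) ∧
    fderiv ℝ Φ.toHomeo q (Ξ (Fin.last n) q) = ((Φ.toHomeo q).1, 0)

/-!
A reduction puts the system in the form `Q(w, p') = 0`, homogeneous in `p'`, in new variables
`(z, w)`. Such equations are preserved by the translations and the dilations of `z`, whose
generators `∂/∂z_i` and `∑ z_j ∂/∂z_j` span the algebra. They are symmetries only as far as the jets
at which `z` can serve as independent variables are concerned, and those are the regular jets of the
algebra (`PointTransformation.Straightens.mem_regularJets_iff`): the linear part of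
`∑ (z_j - z_j(q)) ∂/∂z_j` at `q` is the projection to the `z`-directions, so that it annihilates a
vector `(v, p v)` iff the total derivative of `z` annihilates `v`.

Conversely, let an algebra be given. Its commuting fields `Ξ_1, …, Ξ_n` are straightened
simultaneously (`exists_straighten_commuting`). The integral curves of their constant combinations
solve an integral equation in a space of continuous curves on `[0, 1]`, where the inverse function
theorem yields the curves and their smooth dependence on all parameters at once. The invariants `w`
so obtained are invariants of `Ξ_{n+1}` too, so that `Ξ_{n+1} = ∑ a_j Ξ_j`. The relations
`[Ξ_i, Ξ_{n+1}] = Ξ_i` say that `Ξ_i a_j = δ_ij`, so that `z = a` and `w` are canonical variables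
(`IsReductionAlgebra.exists_straightens`).

In canonical variables, substituting the prolongation and clearing denominators turns the equations
of the system into polynomials in `p'` with coefficients smooth in `(z, w)`. If a jet `(z, w, p')`
satisfies the system, then so do the jets `(z, w, t p')` for `t` near `1`, by the dilation about
`z`, whence all homogeneous components of the polynomials vanish at `p'`. By the translations they
vanish over all points `(z', w)` as well (`eval_homogeneousComponent_pullbackPoly_eq_zero`). Here the
clearing of denominators leaves a factor that vanishes where the old variables are singular. So the
system amounts to the vanishing of these components for all `z` in a ball. Over `ℝ` this can be
expressed by as many equations as before: the squares of the components, made homogeneous of one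
degree by powers of `|p'|²`, are added up and averaged over `z` with a bump function
(`exists_homogeneous_of_isSmoothFamily`). The point `p' = 0` needs a separate argument, because the
constant components are lost there; they vanish since some jet of the system is regular.

For the generic reduction, the symmetry condition passes from a dense set of jets of the variety to
all of them, because the variety is closed and the prolonged transformations are local
homeomorphisms (`PointTransformation.Straightens.isSymmetryOn_univ`).
-/

open Filter Topology

/-! ### Prolongation of point transformations -/

section Prolongation

variable {n m k : ℕ}

/-- The matrix of total derivatives is the derivative along the contact plane of the jet, which
consists of the vectors `(v, p v)`. -/
lemma totalDeriv_mulVec (F : Base n m → (Fin k → ℝ)) (j : Jet n m) (v : Fin n → ℝ) :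
    (totalDeriv F j).mulVec v = fderiv ℝ F j.1 (v, j.2.mulVec v) := by
  have h : ((v, j.2.mulVec v) : Base n m)
      = ∑ i, v i • ((Pi.single i 1, fun α => j.2 α i) : Base n m) := by
    ext a
    · simp [Prod.fst_sum, Finset.sum_apply, Pi.single_apply]
    · simp [Prod.snd_sum, Finset.sum_apply, Matrix.mulVec, dotProduct, mul_comm]
  rw [h, map_sum]
  simp only [map_smul]
  ext a
  simp [totalDeriv, Matrix.mulVec, dotProduct, Finset.sum_apply, mul_comm]

lemma eq_totalDeriv_iff (F : Base n m → (Fin k → ℝ)) (j : Jet n m)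
    (A : Matrix (Fin k) (Fin n) ℝ) :
    totalDeriv F j = A ↔ ∀ v, A.mulVec v = fderiv ℝ F j.1 (v, j.2.mulVec v) := by
  simp only [← totalDeriv_mulVec]
  refine ⟨fun h v => by rw [h], fun h => ?_⟩
  exact Matrix.ext_of_mulVec_single fun i => (h _).symm

lemma totalDeriv_fst_id (j : Jet n m) : totalDeriv (fun q : Base n m => q.1) j = 1 := by
  rw [eq_totalDeriv_iff]
  intro v
  have : fderiv ℝ (fun q : Base n m => q.1) j.1 = ContinuousLinearMap.fst ℝ _ _ :=
    (ContinuousLinearMap.fst ℝ (Fin n → ℝ) (Fin m → ℝ)).fderiv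
  simp [this]

lemma totalDeriv_snd_id (j : Jet n m) : totalDeriv (fun q : Base n m => q.2) j = j.2 := by
  rw [eq_totalDeriv_iff]
  intro v
  have : fderiv ℝ (fun q : Base n m => q.2) j.1 = ContinuousLinearMap.snd ℝ _ _ :=
    (ContinuousLinearMap.snd ℝ (Fin n → ℝ) (Fin m → ℝ)).fderiv
  simp [this]

lemma totalDeriv_congr {F G : Base n m → (Fin k → ℝ)} {j : Jet n m} (h : F =ᶠ[𝓝 j.1] G) :
    totalDeriv F j = totalDeriv G j := by
  simp only [totalDeriv, h.fderiv_eq]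

/-- The matrix identity `p' * D_x Z = D_x W` that characterizes the prolongation. -/
lemma prolong_snd_mul {φ : Base n m → Base n m} {j : Jet n m} (hj : ProlongableAt φ j) :
    (prolong φ j).2 * totalDeriv (fun q => (φ q).1) j = totalDeriv (fun q => (φ q).2) j := by
  have : IsUnit (totalDeriv (fun q => (φ q).1) j).det := isUnit_iff_ne_zero.2 hj
  simp [prolong, Matrix.mul_assoc, Matrix.nonsing_inv_mul _ this]

/-- The derivative of `φ` maps the contact plane of a jet to that of the prolonged jet. -/
lemma fderiv_contact {φ : Base n m → Base n m} {j : Jet n m} (hφ : DifferentiableAt ℝ φ j.1)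
    (hj : ProlongableAt φ j) (v : Fin n → ℝ) :
    fderiv ℝ φ j.1 (v, j.2.mulVec v) =
      ((totalDeriv (fun q => (φ q).1) j).mulVec v,
        (prolong φ j).2.mulVec ((totalDeriv (fun q => (φ q).1) j).mulVec v)) := by
  rw [Matrix.mulVec_mulVec, prolong_snd_mul hj, totalDeriv_mulVec, totalDeriv_mulVec,
    fderiv.fst hφ, fderiv.snd hφ]
  rfl

/-- The chain rule for total derivatives. -/
lemma totalDeriv_comp {G : Base n m → (Fin k → ℝ)} {φ : Base n m → Base n m} {j : Jet n m}
    (hφ : DifferentiableAt ℝ φ j.1) (hG : DifferentiableAt ℝ G (φ j.1)) (hj : ProlongableAt φ j) :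
    totalDeriv (fun q => G (φ q)) j =
      totalDeriv G (prolong φ j) * totalDeriv (fun q => (φ q).1) j := by
  rw [eq_totalDeriv_iff]
  intro v
  have : fderiv ℝ (fun q => G (φ q)) j.1 = (fderiv ℝ G (φ j.1)).comp (fderiv ℝ φ j.1) :=
    fderiv_comp j.1 hG hφ
  rw [this, ← Matrix.mulVec_mulVec, totalDeriv_mulVec, ContinuousLinearMap.comp_apply,
    fderiv_contact hφ hj]
  rfl

lemma prolongableAt_comp {ψ φ : Base n m → Base n m} {j : Jet n m}
    (hφ : DifferentiableAt ℝ φ j.1) (hψ : DifferentiableAt ℝ ψ (φ j.1)) (hj : ProlongableAt φ j) :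
    ProlongableAt (fun q => ψ (φ q)) j ↔ ProlongableAt ψ (prolong φ j) := by
  unfold ProlongableAt at *
  rw [totalDeriv_comp (G := fun q => (ψ q).1) hφ hψ.fst hj, Matrix.det_mul]
  simp [hj]

lemma prolong_comp {ψ φ : Base n m → Base n m} {j : Jet n m}
    (hφ : DifferentiableAt ℝ φ j.1) (hψ : DifferentiableAt ℝ ψ (φ j.1)) (hj : ProlongableAt φ j) :
    prolong (fun q => ψ (φ q)) j = prolong ψ (prolong φ j) := by
  have : IsUnit (totalDeriv (fun q => (φ q).1) j).det := isUnit_iff_ne_zero.2 hj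
  refine Prod.ext rfl ?_
  change totalDeriv (fun q => (ψ (φ q)).2) j * (totalDeriv (fun q => (ψ (φ q)).1) j)⁻¹
    = totalDeriv (fun q => (ψ q).2) (prolong φ j) * (totalDeriv (fun q => (ψ q).1) (prolong φ j))⁻¹
  rw [totalDeriv_comp (G := fun q => (ψ q).1) hφ hψ.fst hj,
    totalDeriv_comp (G := fun q => (ψ q).2) hφ hψ.snd hj, Matrix.mul_inv_rev, Matrix.mul_assoc,
    ← Matrix.mul_assoc _ _ (totalDeriv (fun q => (ψ q).1) (prolong φ j))⁻¹,
    Matrix.mul_nonsing_inv _ this, Matrix.one_mul]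

lemma prolongableAt_congr {ψ φ : Base n m → Base n m} {j : Jet n m} (h : ψ =ᶠ[𝓝 j.1] φ) :
    ProlongableAt ψ j ↔ ProlongableAt φ j := by
  unfold ProlongableAt
  rw [totalDeriv_congr (F := fun q => (ψ q).1) (G := fun q => (φ q).1)
    (h.mono fun q hq => by simp only [hq])]

lemma prolong_congr {ψ φ : Base n m → Base n m} {j : Jet n m} (h : ψ =ᶠ[𝓝 j.1] φ) :
    prolong ψ j = prolong φ j := by
  unfold prolong
  rw [totalDeriv_congr (F := fun q => (ψ q).1) (G := fun q => (φ q).1)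
    (h.mono fun q hq => by simp only [hq]), totalDeriv_congr (F := fun q => (ψ q).2)
    (G := fun q => (φ q).2) (h.mono fun q hq => by simp only [hq]), h.eq_of_nhds]

lemma prolongableAt_id (j : Jet n m) : ProlongableAt (fun q => q) j := by
  simp [ProlongableAt, totalDeriv_fst_id]

lemma prolong_id (j : Jet n m) : prolong (fun q => q) j = j := by
  simp [prolong, totalDeriv_fst_id, totalDeriv_snd_id]

/-- A local left inverse `ψ` of `φ` is prolongable at the image of every jet at which `φ` is. -/
lemma ProlongableAt.of_leftInverse {ψ φ : Base n m → Base n m} {j : Jet n m}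
    (hφ : DifferentiableAt ℝ φ j.1) (hψ : DifferentiableAt ℝ ψ (φ j.1)) (hj : ProlongableAt φ j)
    (h : ∀ᶠ q in 𝓝 j.1, ψ (φ q) = q) :
    ProlongableAt ψ (prolong φ j) ∧ prolong ψ (prolong φ j) = j := by
  rw [← prolongableAt_comp hφ hψ hj, ← prolong_comp hφ hψ hj, prolongableAt_congr h,
    prolong_congr h]
  exact ⟨prolongableAt_id j, prolong_id j⟩

lemma continuousAt_totalDeriv {F : Base n m → (Fin k → ℝ)} {j : Jet n m}
    (hF : ContDiffAt ℝ 1 F j.1) : ContinuousAt (totalDeriv F) j := by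
  have h1 : ContinuousAt (fun j : Jet n m => fderiv ℝ F j.1) j :=
    (hF.continuousAt_fderiv one_ne_zero).comp (f := fun j : Jet n m => j.1) continuousAt_fst
  refine continuousAt_pi.2 fun a => continuousAt_pi.2 fun i => ?_
  have h2 : ContinuousAt (fun j : Jet n m => ((Pi.single i 1, fun α => j.2 α i) : Base n m)) j := by
    fun_prop
  exact (continuous_apply a).continuousAt.comp (h1.clm_apply h2)

lemma continuousAt_prolong {φ : Base n m → Base n m} {j : Jet n m}
    (hφ : ContDiffAt ℝ 1 φ j.1) (hj : ProlongableAt φ j) : ContinuousAt (prolong φ) j := by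
  have h1 := continuousAt_totalDeriv hφ.fst
  have h2 := continuousAt_totalDeriv hφ.snd
  have h3 : ContinuousAt (fun j => (totalDeriv (fun q => (φ q).1) j)⁻¹) j := by
    refine ContinuousAt.comp (g := fun A : Matrix (Fin n) (Fin n) ℝ => A⁻¹) ?_ h1
    refine continuousAt_matrix_inv _ ?_
    rw [Ring.inverse_eq_inv']
    exact continuousAt_inv₀ hj
  refine ContinuousAt.prodMk
    (hφ.continuousAt.comp (f := fun j : Jet n m => j.1) continuousAt_fst) ?_
  exact (continuous_fst.matrix_mul continuous_snd).continuousAt.comp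
    (f := fun j => (totalDeriv (fun q => (φ q).2) j, (totalDeriv (fun q => (φ q).1) j)⁻¹))
    (h2.prodMk h3)

lemma eventually_prolongableAt {φ : Base n m → Base n m} {j : Jet n m}
    (hφ : ContDiffAt ℝ 1 φ j.1) (hj : ProlongableAt φ j) : ∀ᶠ j' in 𝓝 j, ProlongableAt φ j' := by
  have h1 : ContinuousAt (fun j => (totalDeriv (fun q => (φ q).1) j).det) j :=
    ContinuousAt.comp (g := fun A : Matrix (Fin n) (Fin n) ℝ => A.det)
      (Continuous.continuousAt (by fun_prop)) (continuousAt_totalDeriv hφ.fst)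
  exact h1.eventually_ne hj

end Prolongation

/-! ### Inverse functions and superposition operators -/

section InverseFunction

variable {E F : Type*} [NormedAddCommGroup E] [NormedSpace ℝ E] [CompleteSpace E]
  [NormedAddCommGroup F] [NormedSpace ℝ F]

/-- The inverse function theorem for `C^∞` maps, with both the map and its inverse smooth on the
whole of their (open) domains. -/
theorem exists_openPartialHomeomorph_of_contDiffOn {f : E → F} {s : Set E} (hs : IsOpen s)
    (hf : ContDiffOn ℝ ∞ f s) {x₀ : E} (hx₀ : x₀ ∈ s) (f' : E ≃L[ℝ] F)
    (hf' : HasFDerivAt f (f' : E →L[ℝ] F) x₀) :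
    ∃ e : OpenPartialHomeomorph E F, x₀ ∈ e.source ∧ e.source ⊆ s ∧ (∀ x, e x = f x) ∧
      ContDiffOn ℝ ∞ e e.source ∧ ContDiffOn ℝ ∞ e.symm e.target ∧
      ∀ x ∈ e.source, ∃ L : E ≃L[ℝ] F, HasFDerivAt f (L : E →L[ℝ] F) x := by
  have hcd : ∀ x ∈ s, ContDiffAt ℝ ∞ f x := fun x hx => hf.contDiffAt (hs.mem_nhds hx)
  set e₀ := (hcd x₀ hx₀).toOpenPartialHomeomorph f hf' (by simp)
  set t : Set E := s ∩ fderiv ℝ f ⁻¹' Set.range ((↑) : (E ≃L[ℝ] F) → E →L[ℝ] F)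
  have hto : IsOpen t :=
    (hf.continuousOn_fderiv_of_isOpen hs (by simp)).isOpen_inter_preimage hs
      (ContinuousLinearEquiv.isOpen)
  have hx₀t : x₀ ∈ t := ⟨hx₀, f', hf'.fderiv.symm⟩
  have hfd : ∀ x ∈ t, ∃ L : E ≃L[ℝ] F, HasFDerivAt f (L : E →L[ℝ] F) x := by
    rintro x ⟨hxs, L, hL⟩
    exact ⟨L, hL ▸ ((hcd x hxs).differentiableAt (by simp)).hasFDerivAt⟩
  refine ⟨e₀.restrOpen t hto, ⟨(hcd x₀ hx₀).mem_toOpenPartialHomeomorph_source hf' _, hx₀t⟩,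
    fun x hx => hx.2.1, fun x => rfl, hf.mono fun x hx => hx.2.1, fun y hy => ?_,
    fun x hx => hfd x hx.2⟩
  have hmem := (e₀.restrOpen t hto).map_target hy
  obtain ⟨L, hL⟩ := hfd _ hmem.2
  exact ((e₀.restrOpen t hto).contDiffAt_symm hy hL (hcd _ hmem.2.1)).contDiffWithinAt

end InverseFunction

section Superposition

/-- The superposition operator `γ ↦ f ∘ γ` on continuous maps, with the value `0` when `f` is
discontinuous. The spaces live in one universe, because the induction for smoothness replaces `F`
by `E →L[ℝ] F`. -/
noncomputable def superposition (I : Type) [TopologicalSpace I] {E F : Type}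
    [NormedAddCommGroup E] [NormedAddCommGroup F] (f : E → F) : C(I, E) → C(I, F) := by
  classical exact
  fun γ => if h : Continuous f then (⟨f, h⟩ : C(E, F)).comp γ else 0

lemma superposition_apply {I : Type} [TopologicalSpace I] {E F : Type}
    [NormedAddCommGroup E] [NormedAddCommGroup F] {f : E → F} (hf : Continuous f)
    (γ : C(I, E)) (s : I) : superposition I f γ s = f (γ s) := by
  simp [superposition, hf]

lemma continuous_superposition {I : Type} [TopologicalSpace I] {E F : Type}
    [NormedAddCommGroup E] [NormedAddCommGroup F] {f : E → F} (hf : Continuous f) :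
    Continuous (superposition I f) := by
  have : superposition I f = fun γ => (⟨f, hf⟩ : C(E, F)).comp γ := by
    funext γ; simp [superposition, hf]
  rw [this]
  exact ContinuousMap.continuous_postcomp _

variable {I : Type} [TopologicalSpace I] [CompactSpace I]
variable {E F : Type} [NormedAddCommGroup E] [NormedSpace ℝ E]
  [NormedAddCommGroup F] [NormedSpace ℝ F]

/-- Pointwise application of a curve of linear maps to a curve of vectors. -/
noncomputable def pointwiseApply (I : Type) [TopologicalSpace I] [CompactSpace I] (E F : Type)
    [NormedAddCommGroup E] [NormedSpace ℝ E] [NormedAddCommGroup F] [NormedSpace ℝ F] :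
    C(I, E →L[ℝ] F) →L[ℝ] C(I, E) →L[ℝ] C(I, F) :=
  LinearMap.mkContinuous₂
    (LinearMap.mk₂ ℝ (fun (A : C(I, E →L[ℝ] F)) (γ : C(I, E)) =>
        (⟨fun s => A s (γ s), by fun_prop⟩ : C(I, F)))
      (fun _ _ _ => rfl) (fun _ _ _ => rfl)
      (fun _ _ _ => by ext; simp) (fun _ _ _ => by ext; simp)) 1
    (fun A γ => by
      rw [one_mul]
      refine (ContinuousMap.norm_le _ (by positivity)).2 fun s => ?_
      exact ((A s).le_opNorm _).trans
        (by gcongr; exacts [A.norm_coe_le_norm s, γ.norm_coe_le_norm s]))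

@[simp] lemma pointwiseApply_apply (A : C(I, E →L[ℝ] F)) (γ : C(I, E)) (s : I) :
    pointwiseApply I E F A γ s = A s (γ s) := rfl

lemma hasFDerivAt_superposition {f : E → F} (hf : ContDiff ℝ 1 f) (γ : C(I, E)) :
    HasFDerivAt (superposition I f) (pointwiseApply I E F (superposition I (fderiv ℝ f) γ)) γ := by
  have hf' : Continuous (fderiv ℝ f) := hf.continuous_fderiv one_ne_zero
  rw [hasFDerivAt_iff_isLittleO_nhds_zero, Asymptotics.isLittleO_iff]
  intro c hc
  obtain ⟨δ, hδ, H⟩ := Metric.continuousAt_iff.1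
    ((continuous_superposition (I := I) hf').continuousAt (x := γ)) c hc
  filter_upwards [Metric.ball_mem_nhds (0 : C(I, E)) hδ] with h hh
  refine (ContinuousMap.norm_le _ (by positivity)).2 fun s => ?_
  have hhs : ‖h s‖ ≤ ‖h‖ := h.norm_coe_le_norm s
  have hh' : ‖h‖ < δ := by simpa using hh
  -- a point near `γ s` is the value at `s` of a translate of `γ`
  have key : ∀ e ∈ Metric.ball (γ s) δ, ‖fderiv ℝ f e - fderiv ℝ f (γ s)‖ ≤ c := by
    intro e he
    have h1 : dist (γ + ContinuousMap.const I (e - γ s)) γ < δ := by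
      rw [dist_eq_norm, add_sub_cancel_left]
      refine (ContinuousMap.norm_lt_iff _ hδ).2 fun _ => ?_
      simpa [dist_eq_norm] using he
    have h2 := (ContinuousMap.dist_apply_le_dist s).trans (H h1).le
    simpa [superposition_apply hf', dist_eq_norm] using h2
  have := (convex_ball (γ s) δ).norm_image_sub_le_of_norm_hasFDerivWithin_le' (f := f)
    (f' := fderiv ℝ f) (φ := fderiv ℝ f (γ s)) (C := c) (x := γ s) (y := γ s + h s)
    (fun x _ => (hf.differentiable one_ne_zero x).hasFDerivAt.hasFDerivWithinAt) key
    (Metric.mem_ball_self hδ) (by simpa using hhs.trans_lt hh')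
  simp only [add_sub_cancel_left] at this
  simp only [ContinuousMap.sub_apply, superposition_apply hf.continuous, ContinuousMap.add_apply,
    pointwiseApply_apply, superposition_apply hf']
  exact this.trans (by gcongr)

/-- The superposition operator of a smooth map is smooth, since its derivative is built from the
superposition operator of the derivative. -/
theorem contDiff_superposition {f : E → F} (hf : ContDiff ℝ ∞ f) :
    ContDiff ℝ ∞ (superposition I f) := by
  refine contDiff_infty.2 fun k => ?_
  induction k generalizing F with
  | zero => exact contDiff_zero.2 (continuous_superposition hf.continuous)
  | succ k ih =>
    refine (contDiff_succ_iff_hasFDerivAt (n := k)).2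
      ⟨fun γ => pointwiseApply I E F (superposition I (fderiv ℝ f) γ), ?_,
        fun γ => hasFDerivAt_superposition (hf.of_le (by simp)) γ⟩
    exact (pointwiseApply I E F).contDiff.comp (ih (contDiff_infty_iff_fderiv.1 hf).2)

end Superposition

/-! ### Flow boxes of commuting vector fields -/

section Volterra

variable {E : Type} [NormedAddCommGroup E] [NormedSpace ℝ E]

/-- The integration operator `γ ↦ (t ↦ ∫ s in 0..t, γ s)` on the continuous curves on `[0, 1]`. -/
noncomputable def primitiveCurve (E : Type) [NormedAddCommGroup E] [NormedSpace ℝ E] :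
    C(Set.Icc (0 : ℝ) 1, E) →L[ℝ] C(Set.Icc (0 : ℝ) 1, E) :=
  LinearMap.mkContinuous
    { toFun := fun γ => ⟨fun t => ∫ s in (0 : ℝ)..t, Set.IccExtend zero_le_one γ s,
        (intervalIntegral.continuous_primitive
          (fun _ _ => (γ.continuous.Icc_extend').intervalIntegrable _ _) 0).comp
          continuous_subtype_val⟩
      map_add' := fun γ η => by
        ext t
        exact intervalIntegral.integral_add ((γ.continuous.Icc_extend').intervalIntegrable _ _)
          ((η.continuous.Icc_extend').intervalIntegrable _ _)
      map_smul' := fun c γ => by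
        ext t
        exact intervalIntegral.integral_smul c _ } 1
    (fun γ => by
      refine (ContinuousMap.norm_le _ (by positivity)).2 fun t => ?_
      have := intervalIntegral.norm_integral_le_of_norm_le_const (a := 0) (b := (t : ℝ))
        (f := Set.IccExtend zero_le_one γ) (C := ‖γ‖) (fun s _ => γ.norm_coe_le_norm _)
      refine this.trans ?_
      rw [sub_zero, abs_of_nonneg t.2.1, one_mul]
      exact mul_le_of_le_one_right (norm_nonneg _) t.2.2)

lemma primitiveCurve_apply (γ : C(Set.Icc (0 : ℝ) 1, E)) (t : Set.Icc (0 : ℝ) 1) :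
    primitiveCurve E γ t = ∫ s in (0 : ℝ)..t, Set.IccExtend zero_le_one γ s := rfl

lemma IccExtend_primitiveCurve_hasDerivAt [CompleteSpace E] (γ : C(Set.Icc (0 : ℝ) 1, E)) {t : ℝ}
    (ht : t ∈ Set.Ioo (0 : ℝ) 1) :
    HasDerivAt (Set.IccExtend zero_le_one (primitiveCurve E γ))
      (Set.IccExtend zero_le_one γ t) t := by
  have h := (intervalIntegral.integral_hasDerivAt_right (a := 0) (b := t)
    ((γ.continuous.Icc_extend' (h := zero_le_one)).intervalIntegrable _ _)
    ((γ.continuous.Icc_extend').stronglyMeasurableAtFilter _ _)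
    (γ.continuous.Icc_extend').continuousAt)
  refine h.congr_of_eventuallyEq ?_
  filter_upwards [Ioo_mem_nhds ht.1 ht.2] with s hs
  rw [Set.IccExtend_of_mem _ _ (Set.Ioo_subset_Icc_self hs)]
  rfl

/-- A continuous curve that starts at `0` and is differentiable is the primitive of its
derivative. -/
lemma eq_primitiveCurve [CompleteSpace E] {γ η : C(Set.Icc (0 : ℝ) 1, E)} (h0 : η ⟨0, by simp⟩ = 0)
    (h : ∀ t ∈ Set.Ioo (0 : ℝ) 1, HasDerivAt (Set.IccExtend zero_le_one η)
      (Set.IccExtend zero_le_one γ t) t) : η = primitiveCurve E γ := by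
  ext t
  rw [primitiveCurve_apply, intervalIntegral.integral_eq_sub_of_hasDerivAt_of_le t.2.1
    (η.continuous.Icc_extend').continuousOn
    (fun x hx => h x ⟨hx.1, hx.2.trans_le t.2.2⟩)
    ((γ.continuous.Icc_extend').intervalIntegrable _ _)]
  rw [Set.IccExtend_of_mem _ _ t.2,
    Set.IccExtend_of_mem _ _ (by simp : (0 : ℝ) ∈ Set.Icc (0 : ℝ) 1), h0, sub_zero]

/-- The constant curves, as a continuous linear map. -/
noncomputable def constCurve (E : Type) [NormedAddCommGroup E] [NormedSpace ℝ E] :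
    E →L[ℝ] C(Set.Icc (0 : ℝ) 1, E) :=
  LinearMap.mkContinuous
    { toFun := fun x => ContinuousMap.const _ x
      map_add' := fun _ _ => rfl
      map_smul' := fun _ _ => rfl } 1
    (fun x => by
      refine (ContinuousMap.norm_le _ (by positivity)).2 fun t => ?_
      rw [one_mul]
      exact le_refl ‖x‖)

@[simp] lemma constCurve_apply (x : E) (t : Set.Icc (0 : ℝ) 1) : constCurve E x t = x := rfl

end Volterra

section FlowBox

variable {n m : ℕ}

/-- The map whose zeros in the second component are the pairs of `a = (z, w)` and an integral
curve over `[0, 1]` of `∑ i, z i • X i` that starts at `q₀ + S w`. -/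
noncomputable def integralEquation (X : Fin n → Base n m → Base n m)
    (S : (Fin m → ℝ) →L[ℝ] Base n m) (q₀ : Base n m)
    (p : Base n m × C(Set.Icc (0 : ℝ) 1, Base n m)) :
    Base n m × C(Set.Icc (0 : ℝ) 1, Base n m) :=
  (p.1, p.2 - constCurve _ (q₀ + S p.1.2) -
    primitiveCurve _ (∑ i, p.1.1 i • superposition _ (X i) p.2))

lemma contDiff_integralEquation {X : Fin n → Base n m → Base n m} (hX : ∀ i, ContDiff ℝ ∞ (X i))
    (S : (Fin m → ℝ) →L[ℝ] Base n m) (q₀ : Base n m) :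
    ContDiff ℝ ∞ (integralEquation X S q₀) := by
  have h1 : ContDiff ℝ ∞ fun p : Base n m × C(Set.Icc (0 : ℝ) 1, Base n m) =>
      ∑ i, p.1.1 i • superposition (Set.Icc (0 : ℝ) 1) (X i) p.2 := by
    refine ContDiff.sum fun i _ => ContDiff.smul
      ((contDiff_apply ℝ ℝ i).comp (contDiff_fst.comp contDiff_fst)) ?_
    exact (contDiff_superposition (hX i)).comp contDiff_snd
  have h2 : ContDiff ℝ ∞ fun p : Base n m × C(Set.Icc (0 : ℝ) 1, Base n m) =>
      constCurve (Base n m) (q₀ + S p.1.2) := by fun_prop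
  exact contDiff_fst.prodMk
    ((contDiff_snd.sub h2).sub ((primitiveCurve (Base n m)).contDiff.comp h1))

/-- The derivative of `integralEquation` is the linearized integral equation. -/
lemma fderiv_integralEquation {X : Fin n → Base n m → Base n m} (hX : ∀ i, ContDiff ℝ ∞ (X i))
    (S : (Fin m → ℝ) →L[ℝ] Base n m) (q₀ : Base n m)
    (p q : Base n m × C(Set.Icc (0 : ℝ) 1, Base n m)) :
    fderiv ℝ (integralEquation X S q₀) p q = (q.1, q.2 - constCurve _ (S q.1.2) -
      primitiveCurve _ (∑ i,
        (p.1.1 i • pointwiseApply _ _ _ (superposition _ (fderiv ℝ (X i)) p.2) q.2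
        + q.1.1 i • superposition _ (X i) p.2))) := by
  have h0 : ∀ i, HasFDerivAt (fun p : Base n m × C(Set.Icc (0 : ℝ) 1, Base n m) =>
      superposition (Set.Icc (0 : ℝ) 1) (X i) p.2) _ p := fun i =>
    (hasFDerivAt_superposition ((hX i).of_le (by simp)) p.2).comp p hasFDerivAt_snd
  have h0' : ∀ i, HasFDerivAt (fun p : Base n m × C(Set.Icc (0 : ℝ) 1, Base n m) => p.1.1 i)
      (((ContinuousLinearMap.proj i).comp (ContinuousLinearMap.fst ℝ (Fin n → ℝ) (Fin m → ℝ))).comp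
        (ContinuousLinearMap.fst ℝ (Base n m) C(Set.Icc (0 : ℝ) 1, Base n m))) p := fun i =>
    ContinuousLinearMap.hasFDerivAt
      (((ContinuousLinearMap.proj i).comp (ContinuousLinearMap.fst ℝ (Fin n → ℝ) (Fin m → ℝ))).comp
        (ContinuousLinearMap.fst ℝ (Base n m) C(Set.Icc (0 : ℝ) 1, Base n m)))
  have h1 := HasFDerivAt.fun_sum (u := Finset.univ) (fun i _ => (h0' i).smul (h0 i))
  have h2 : HasFDerivAt (fun p : Base n m × C(Set.Icc (0 : ℝ) 1, Base n m) =>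
      constCurve (Base n m) (q₀ + S p.1.2)) ((constCurve (Base n m)).comp (S.comp
        ((ContinuousLinearMap.snd ℝ (Fin n → ℝ) (Fin m → ℝ)).comp
        (ContinuousLinearMap.fst ℝ (Base n m) C(Set.Icc (0 : ℝ) 1, Base n m))))) p :=
    (constCurve (Base n m)).hasFDerivAt.comp p ((ContinuousLinearMap.hasFDerivAt (S.comp
        ((ContinuousLinearMap.snd ℝ (Fin n → ℝ) (Fin m → ℝ)).comp
        (ContinuousLinearMap.fst ℝ (Base n m) C(Set.Icc (0 : ℝ) 1, Base n m))))).const_add q₀)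
  have h3 : HasFDerivAt (integralEquation X S q₀) _ p := hasFDerivAt_fst.prodMk
    ((hasFDerivAt_snd.sub h2).sub ((primitiveCurve (Base n m)).hasFDerivAt.comp p h1))
  rw [h3.fderiv]
  simp

/-- **Flow boxes for commuting vector fields.** If `S` parametrizes a transversal, there is a
smooth map `Ψ` near `0` that takes `∂/∂z_i` to `X i`. Here `Ψ (z, w)` is the endpoint at time `1` of
the integral curve of `∑ i, z i • X i` from `q₀ + S w`. The inverse function theorem for
`integralEquation` yields the curve and its smooth dependence on `(z, w)`. As the fields commute,
`s • X i (γ s)` solves the linearized equation, and its value at `s = 1` is the derivative of `Ψ`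
along `∂/∂z_i`. -/
theorem exists_flowBox {X : Fin n → Base n m → Base n m} (hX : ∀ i, ContDiff ℝ ∞ (X i))
    (S : (Fin m → ℝ) →L[ℝ] Base n m) (q₀ : Base n m) {V : Set (Base n m)} (hV : IsOpen V)
    (hq₀ : q₀ ∈ V)
    (hcomm : ∀ i j, ∀ q ∈ V, fderiv ℝ (X j) q (X i q) = fderiv ℝ (X i) q (X j q)) :
    ∃ (T : Set (Base n m)) (Ψ : Base n m → Base n m), IsOpen T ∧ 0 ∈ T ∧ ContDiffOn ℝ ∞ Ψ T ∧
      Ψ 0 = q₀ ∧ (∀ b, fderiv ℝ Ψ 0 b = ∑ i, b.1 i • X i q₀ + S b.2) ∧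
      ∀ a ∈ T, Ψ a ∈ V ∧ ∀ i, fderiv ℝ Ψ a (Pi.single i 1, 0) = X i (Ψ a) := by
  set H := integralEquation X S q₀ with hH
  have hHs : ContDiff ℝ ∞ H := contDiff_integralEquation hX S q₀
  set γ₀ : C(Set.Icc (0 : ℝ) 1, Base n m) := constCurve _ q₀ with hγ₀
  have hH0 : H (0, γ₀) = (0, 0) := by simp [hH, integralEquation, hγ₀]
  -- at the constant curve the derivative of `H` is a shear
  set L₀ : Base n m →L[ℝ] C(Set.Icc (0 : ℝ) 1, Base n m) :=
    ((constCurve (Base n m)).comp (S.comp (ContinuousLinearMap.snd ℝ (Fin n → ℝ) (Fin m → ℝ))) +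
      (primitiveCurve _).comp (∑ i, ((ContinuousLinearMap.proj i).comp
        (ContinuousLinearMap.fst ℝ (Fin n → ℝ) (Fin m → ℝ))).smulRight
          (superposition _ (X i) γ₀))) with hL₀
  have hL₀a : ∀ b, L₀ b = constCurve _ (S b.2) +
      primitiveCurve _ (∑ i, b.1 i • superposition _ (X i) γ₀) := by
    intro b
    simp [hL₀]
  have hder0 : fderiv ℝ H (0, γ₀) = (ContinuousLinearEquiv.skewProd (ContinuousLinearEquiv.refl ℝ
      (Base n m)) (ContinuousLinearEquiv.refl ℝ _) (-L₀) : _ →L[ℝ] _) := by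
    refine ContinuousLinearMap.ext fun q => ?_
    rw [fderiv_integralEquation hX]
    simp [ContinuousLinearEquiv.skewProd_apply, hL₀a]
    abel
  have hO : IsOpen {p : Base n m × C(Set.Icc (0 : ℝ) 1, Base n m) | Set.MapsTo p.2 Set.univ V} :=
    (ContinuousMap.isOpen_setOfPred_mapsTo isCompact_univ hV).preimage continuous_snd
  obtain ⟨e, he0, heO, heH, -, hes, heL⟩ := exists_openPartialHomeomorph_of_contDiffOn hO
    hHs.contDiffOn (x₀ := (0, γ₀)) (fun _ _ => hq₀) _
    (hder0 ▸ (hHs.differentiable (by simp) (0, γ₀)).hasFDerivAt)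
  have heHf : ⇑e = H := funext heH
  have h00 : ((0, 0) : Base n m × C(Set.Icc (0 : ℝ) 1, Base n m)) ∈ e.target := by
    rw [← hH0, ← heH]; exact e.map_source he0
  have hs0 : e.symm (0, 0) = (0, γ₀) := by rw [← hH0, ← heH]; exact e.left_inv he0
  set j : Base n m →L[ℝ] Base n m × C(Set.Icc (0 : ℝ) 1, Base n m) :=
    ContinuousLinearMap.inl ℝ _ _
  set one : Set.Icc (0 : ℝ) 1 := ⟨1, by simp⟩ with hone
  set ev : Base n m × C(Set.Icc (0 : ℝ) 1, Base n m) →L[ℝ] Base n m :=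
    (ContinuousMap.evalCLM ℝ one).comp (ContinuousLinearMap.snd ℝ _ _)
  have hT : IsOpen (j ⁻¹' e.target) := e.open_target.preimage j.continuous
  -- the derivative of the solution is determined by the linearized equation
  have key : ∀ a ∈ j ⁻¹' e.target, ∀ (b : Base n m) (η : C(Set.Icc (0 : ℝ) 1, Base n m)),
      fderiv ℝ H (e.symm (a, 0)) (b, η) = (b, 0) →
        fderiv ℝ (fun a => ev (e.symm (j a))) a b = η one := by
    intro a ha b η hη
    obtain ⟨L, hL⟩ := heL _ (e.map_target ha)
    have h1 : HasFDerivAt e.symm (L.symm : _ →L[ℝ] _) (j a) :=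
      e.hasFDerivAt_symm ha (by rw [heHf]; exact hL)
    have h2 : HasFDerivAt (fun a => ev (e.symm (j a))) _ a :=
      ev.hasFDerivAt.comp a (h1.comp a j.hasFDerivAt)
    have h3 : L (b, η) = (b, 0) := by
      rw [← hη]
      exact (DFunLike.congr_fun hL.fderiv (b, η)).symm
    have h4 : L.symm (b, 0) = (b, η) := by rw [← h3]; exact L.symm_apply_apply _
    rw [h2.fderiv]
    change ev (L.symm (b, 0)) = _
    rw [h4]
    rfl
  refine ⟨j ⁻¹' e.target, fun a => ev (e.symm (j a)), hT, h00,
    ev.contDiff.comp_contDiffOn (hes.comp j.contDiff.contDiffOn fun a ha => ha), ?_, fun b => ?_,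
    fun a ha => ⟨?_, fun i => ?_⟩⟩
  · change ev (e.symm (0, 0)) = q₀
    rw [hs0]; rfl
  · rw [key 0 h00 b (L₀ b)]
    · rw [hL₀a, ContinuousMap.add_apply, primitiveCurve_apply]
      have : ∀ s : ℝ, Set.IccExtend zero_le_one
          (⇑(∑ i, b.1 i • superposition (Set.Icc (0 : ℝ) 1) (X i) γ₀)) s =
            ∑ i, b.1 i • X i q₀ := by
        intro s
        simp [Set.IccExtend, superposition_apply (hX _).continuous, hγ₀]
      simp only [this]
      simp [hone, add_comm]
    · rw [hs0, hder0]
      simp [ContinuousLinearEquiv.skewProd_apply]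
  · exact heO (e.map_target ha) (Set.mem_univ one)
  · have hp1 : H (e.symm (a, 0)) = (a, 0) := by rw [← heH]; exact e.right_inv ha
    have hpV : ∀ s, (e.symm (a, 0)).2 s ∈ V := fun s => heO (e.map_target ha) (Set.mem_univ s)
    obtain ⟨⟨p1, γ⟩, he⟩ : ∃ p, e.symm (a, 0) = p := ⟨_, rfl⟩
    rw [he] at hp1 hpV
    have : p1 = a := by simpa [hH, integralEquation] using congrArg Prod.fst hp1
    subst this
    simp only at hpV
    have hγ : γ = constCurve _ (q₀ + S p1.2) +
        primitiveCurve _ (∑ i, p1.1 i • superposition _ (X i) γ) := by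
      have := congrArg Prod.snd hp1
      simp only [hH, integralEquation] at this
      rw [sub_sub, sub_eq_zero] at this
      exact this
    set γ' : C(Set.Icc (0 : ℝ) 1, Base n m) := ∑ i, p1.1 i • superposition _ (X i) γ with hγ'
    have hdγ : ∀ t ∈ Set.Ioo (0 : ℝ) 1, HasDerivAt (Set.IccExtend zero_le_one γ)
        (Set.IccExtend zero_le_one γ' t) t := by
      intro t ht
      have := (IccExtend_primitiveCurve_hasDerivAt γ' ht).const_add (q₀ + S p1.2)
      refine this.congr_of_eventuallyEq (Eventually.of_forall fun s => ?_)
      conv_lhs => rw [hγ]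
      rfl
    -- the field `s • X i (γ s)` along the curve solves the linearized equation
    set η : C(Set.Icc (0 : ℝ) 1, Base n m) :=
      ⟨fun s => (s : ℝ) • X i (γ s), by have := (hX i).continuous; fun_prop⟩ with hη
    rw [key p1 ha _ η]
    · change (1 : ℝ) • X i (γ one) = X i (ev (e.symm (p1, 0)))
      rw [one_smul, he]; rfl
    · rw [he, hH, fderiv_integralEquation hX]
      refine Prod.ext rfl ?_
      simp only [map_zero, sub_zero, sub_eq_zero]
      refine eq_primitiveCurve (by simp [hη]) fun t ht => ?_
      have h1 := (hasDerivAt_id t).smul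
        (((hX i).differentiable (by simp) _).hasFDerivAt.comp_hasDerivAt t (hdγ t ht))
      have h2 := h1.congr_of_eventuallyEq (f₁ := Set.IccExtend zero_le_one η) (by
        filter_upwards [Ioo_mem_nhds ht.1 ht.2] with s hs
        simp only [Set.IccExtend_of_mem _ _ (Set.Ioo_subset_Icc_self hs), hη, Function.comp_apply,
          Pi.smul_apply']
        rfl)
      convert h2 using 1
      have htI := Set.Ioo_subset_Icc_self ht
      simp only [Set.IccExtend_of_mem _ _ htI, Function.comp_apply, hγ', ContinuousMap.sum_apply,
        ContinuousMap.add_apply, ContinuousMap.smul_apply, pointwiseApply_apply,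
        superposition_apply (hX _).continuous,
        superposition_apply ((hX _).continuous_fderiv (by simp)), hη, map_sum, map_smul,
        ContinuousMap.coe_mk, Finset.sum_add_distrib, Finset.smul_sum, id, one_smul]
      congr 1
      · refine Finset.sum_congr rfl fun k _ => ?_
        rw [hcomm i k _ (hpV _), smul_comm]
      · rw [Finset.sum_eq_single i (fun k _ hk => by simp [hk]) (by simp)]
        simp

end FlowBox

/-! ### Canonical variables of the algebra -/

section CanonicalVariables

variable {n m : ℕ}

namespace PointTransformation

lemma contDiffAt (Φ : PointTransformation n m) {q : Base n m} (hq : q ∈ Φ.toHomeo.source) :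
    ContDiffAt ℝ ∞ Φ.toHomeo q :=
  Φ.smooth.contDiffAt (Φ.toHomeo.open_source.mem_nhds hq)

lemma contDiffAt_symm (Φ : PointTransformation n m) {y : Base n m} (hy : y ∈ Φ.toHomeo.target) :
    ContDiffAt ℝ ∞ Φ.toHomeo.symm y :=
  Φ.smooth_symm.contDiffAt (Φ.toHomeo.open_target.mem_nhds hy)

lemma differentiableAt (Φ : PointTransformation n m) {q : Base n m} (hq : q ∈ Φ.toHomeo.source) :
    DifferentiableAt ℝ Φ.toHomeo q :=
  (Φ.contDiffAt hq).differentiableAt (by simp)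

lemma differentiableAt_symm (Φ : PointTransformation n m) {y : Base n m}
    (hy : y ∈ Φ.toHomeo.target) : DifferentiableAt ℝ Φ.toHomeo.symm y :=
  (Φ.contDiffAt_symm hy).differentiableAt (by simp)

/-- The inverse point transformation. -/
noncomputable def symm (Φ : PointTransformation n m) : PointTransformation n m :=
  ⟨Φ.toHomeo.symm, Φ.smooth_symm, Φ.smooth⟩

/-- The restriction of a point transformation to an open set. -/
noncomputable def restrict (Φ : PointTransformation n m) (s : Set (Base n m)) (hs : IsOpen s) :
    PointTransformation n m :=
  ⟨Φ.toHomeo.restrOpen s hs, Φ.smooth.mono fun _ h => h.1,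
    Φ.smooth_symm.mono fun _ h => h.1⟩

lemma fderiv_symm_fderiv (Φ : PointTransformation n m) {q : Base n m}
    (hq : q ∈ Φ.toHomeo.source) (v : Base n m) :
    fderiv ℝ Φ.toHomeo.symm (Φ.toHomeo q) (fderiv ℝ Φ.toHomeo q v) = v := by
  have h := (Φ.differentiableAt_symm (Φ.toHomeo.map_source hq)).hasFDerivAt.comp q
    (Φ.differentiableAt hq).hasFDerivAt
  have h' := h.unique ((hasFDerivAt_id q).congr_of_eventuallyEq
    (Φ.toHomeo.eventually_left_inverse hq))
  exact DFunLike.congr_fun h' v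

lemma fderiv_fderiv_symm (Φ : PointTransformation n m) {q : Base n m}
    (hq : q ∈ Φ.toHomeo.source) (v : Base n m) :
    fderiv ℝ Φ.toHomeo q (fderiv ℝ Φ.toHomeo.symm (Φ.toHomeo q) v) = v := by
  have := Φ.symm.fderiv_symm_fderiv (Φ.toHomeo.map_source hq) v
  change fderiv ℝ Φ.toHomeo (Φ.toHomeo.symm (Φ.toHomeo q)) _ = v at this
  rwa [Φ.toHomeo.left_inv hq] at this

lemma fderiv_injective (Φ : PointTransformation n m) {q : Base n m}
    (hq : q ∈ Φ.toHomeo.source) : Function.Injective (fderiv ℝ Φ.toHomeo q) :=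
  Function.LeftInverse.injective (Φ.fderiv_symm_fderiv hq)

end PointTransformation

/-- A smooth map with injective derivative at `q₀` is a point transformation near `q₀`. -/
theorem exists_pointTransformation {f : Base n m → Base n m} {U : Set (Base n m)} (hU : IsOpen U)
    (hf : ContDiffOn ℝ ∞ f U) {q₀ : Base n m} (hq₀ : q₀ ∈ U)
    (hinj : Function.Injective (fderiv ℝ f q₀)) :
    ∃ Φ : PointTransformation n m, q₀ ∈ Φ.toHomeo.source ∧ Φ.toHomeo.source ⊆ U ∧
      ⇑Φ.toHomeo = f := by
  obtain ⟨e, h1, h2, h3, h4, h5, -⟩ := exists_openPartialHomeomorph_of_contDiffOn hU hf hq₀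
    (LinearEquiv.ofInjectiveEndo (fderiv ℝ f q₀ : Base n m →ₗ[ℝ] Base n m)
      hinj).toContinuousLinearEquiv
    (by
      have := ((hf.contDiffAt (hU.mem_nhds hq₀)).differentiableAt (by simp)).hasFDerivAt
      convert this using 1
      exact ContinuousLinearMap.ext fun v => rfl)
  exact ⟨⟨e, h4, h5⟩, h1, h2, funext h3⟩

/-- Every linearly independent family of `n` vectors has a linear complement parametrized
by `ℝᵐ`. -/
lemma exists_transversal {X : Fin n → Base n m} (hX : LinearIndependent ℝ X) :
    ∃ S : (Fin m → ℝ) →L[ℝ] Base n m,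
      ∀ b : Base n m, ∑ i, b.1 i • X i + S b.2 = 0 → b = 0 := by
  obtain ⟨C, hC⟩ := Submodule.exists_isCompl (Submodule.span ℝ (Set.range X))
  have hdim : Module.finrank ℝ (Fin m → ℝ) = Module.finrank ℝ C := by
    have h1 := Submodule.finrank_add_eq_of_isCompl hC
    have h2 := finrank_span_eq_card hX
    simp at h1 h2
    simp; omega
  set e := LinearEquiv.ofFinrankEq (Fin m → ℝ) C hdim
  refine ⟨(C.subtype ∘ₗ (e : (Fin m → ℝ) →ₗ[ℝ] C)).toContinuousLinearMap, fun b hb => ?_⟩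
  have hb' : ∑ i, b.1 i • X i + (e b.2 : Base n m) = 0 := hb
  have h1 : ∑ i, b.1 i • X i ∈ Submodule.span ℝ (Set.range X) :=
    Submodule.sum_mem _ fun i _ => Submodule.smul_mem _ _ (Submodule.subset_span ⟨i, rfl⟩)
  have h2 : ∑ i, b.1 i • X i ∈ C := by
    rw [eq_neg_of_add_eq_zero_left hb']
    exact C.neg_mem (e b.2).2
  have h3 : ∑ i, b.1 i • X i = 0 := Submodule.disjoint_def.1 hC.disjoint _ h1 h2
  rw [h3, zero_add, ZeroMemClass.coe_eq_zero, LinearEquiv.map_eq_zero_iff] at hb'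
  exact Prod.ext (funext (Fintype.linearIndependent_iff.1 hX _ h3)) hb'

/-- Smooth vector fields near a point can be extended to the whole space. -/
lemma exists_contDiff_eqOn_ball {ι E F : Type*} [NormedAddCommGroup E] [NormedSpace ℝ E]
    [FiniteDimensional ℝ E] [NormedAddCommGroup F] [NormedSpace ℝ F] {U : Set E} (hU : IsOpen U)
    {q₀ : E} (hq₀ : q₀ ∈ U) {f : ι → E → F} (hf : ∀ i, ContDiffOn ℝ ∞ (f i) U) :
    ∃ r > 0, Metric.ball q₀ r ⊆ U ∧ ∃ g : ι → E → F, (∀ i, ContDiff ℝ ∞ (g i)) ∧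
      ∀ i, Set.EqOn (g i) (f i) (Metric.ball q₀ r) := by
  obtain ⟨r, hr, hrU⟩ := Metric.isOpen_iff.1 hU q₀ hq₀
  let χ : ContDiffBump q₀ := ⟨r / 3, r / 2, by positivity, by linarith⟩
  refine ⟨r / 3, by positivity, (Metric.ball_subset_ball (by linarith)).trans hrU,
    fun i x => χ x • f i x, fun i => contDiff_iff_contDiffAt.2 fun x => ?_, fun i x hx => ?_⟩
  · by_cases hx : x ∈ Metric.closedBall q₀ (r / 2)
    · have hxU : x ∈ U := hrU (Metric.closedBall_subset_ball (by linarith) hx)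
      exact χ.contDiff.contDiffAt.smul ((hf i).contDiffAt (hU.mem_nhds hxU))
    · refine (contDiffAt_const (c := (0 : F))).congr_of_eventuallyEq ?_
      filter_upwards [Metric.isClosed_closedBall.isOpen_compl.mem_nhds hx] with y hy
      rw [χ.zero_of_le_dist (not_le.1 fun h => hy h).le, zero_smul]
  · simp only
    rw [χ.one_of_mem_closedBall (Metric.ball_subset_closedBall hx), one_smul]

/-- Commuting independent vector fields are straightened simultaneously. -/
theorem exists_straighten_commuting {U : Set (Base n m)} (hU : IsOpen U) {q₀ : Base n m}
    (hq₀ : q₀ ∈ U) {X : Fin n → Base n m → Base n m} (hX : ∀ i, ContDiffOn ℝ ∞ (X i) U)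
    (hli : LinearIndependent ℝ fun i => X i q₀)
    (hcomm : ∀ i j, ∀ q ∈ U, VectorField.lieBracket ℝ (X i) (X j) q = 0) :
    ∃ Φ : PointTransformation n m, q₀ ∈ Φ.toHomeo.source ∧ Φ.toHomeo.source ⊆ U ∧
      ∀ q ∈ Φ.toHomeo.source, ∀ i, fderiv ℝ Φ.toHomeo q (X i q) = (Pi.single i 1, 0) := by
  obtain ⟨r, hr, hrU, Y, hY, hYX⟩ := exists_contDiff_eqOn_ball hU hq₀ hX
  obtain ⟨S, hS⟩ := exists_transversal hli
  have hev : ∀ q ∈ Metric.ball q₀ r, ∀ i, Y i =ᶠ[𝓝 q] X i := fun q hq i =>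
    (hYX i).eventuallyEq_of_mem (Metric.isOpen_ball.mem_nhds hq)
  obtain ⟨T, Ψ, hT, h0, hΨ, hΨ0, hd0, hd⟩ := exists_flowBox hY S q₀ Metric.isOpen_ball
    (Metric.mem_ball_self hr) (fun i j q hq => by
      have := hcomm i j q (hrU hq)
      rw [VectorField.lieBracket, sub_eq_zero] at this
      rw [(hev q hq i).fderiv_eq, (hev q hq j).fderiv_eq, (hev q hq i).eq_of_nhds,
        (hev q hq j).eq_of_nhds, this])
  obtain ⟨Θ, h0Θ, hΘT, hΘ⟩ := exists_pointTransformation hT hΨ h0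
    ((injective_iff_map_eq_zero _).2 fun b hb => hS b (by
      rw [hd0] at hb
      simpa only [hYX _ (Metric.mem_ball_self hr)] using hb))
  have hmem : ∀ q ∈ Θ.toHomeo.target, q ∈ Metric.ball q₀ r := by
    intro q hq
    have := (hd _ (hΘT (Θ.toHomeo.map_target hq))).1
    rwa [← hΘ, Θ.toHomeo.right_inv hq] at this
  refine ⟨Θ.symm, ?_, fun q hq => hrU (hmem q hq), fun q hq i => ?_⟩
  · have := Θ.toHomeo.map_source h0Θ
    rwa [hΘ, hΨ0] at this
  · have h1 := (hd _ (hΘT (Θ.toHomeo.map_target hq))).2 i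
    rw [← hΘ, Θ.toHomeo.right_inv hq, hYX i (hmem q hq)] at h1
    have h2 := Θ.fderiv_symm_fderiv (Θ.toHomeo.map_target hq) (Pi.single i 1, 0)
    rwa [h1, Θ.toHomeo.right_inv hq] at h2

/-- Canonical variables for the algebra. The invariants `W` come from straightening `Ξ_1, …, Ξ_n`.
As they are invariants of `Ξ_{n+1}`, one has `Ξ_{n+1} = ∑ a_i Ξ_i` for smooth functions `a_i`, and
the bracket relations say that `Ξ_i a_j = δ_ij`, so that the `a_j` are the new independent
variables. -/
theorem IsReductionAlgebra.exists_straightens {U : Set (Base n m)} (hU : IsOpen U) {q₀ : Base n m}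
    (hq₀ : q₀ ∈ U) {Ξ : Fin (n + 1) → Base n m → Base n m} (hΞ : IsReductionAlgebra U Ξ) :
    ∃ Φ : PointTransformation n m, q₀ ∈ Φ.toHomeo.source ∧ Φ.toHomeo.source ⊆ U ∧
      Φ.Straightens Ξ := by
  obtain ⟨Θ, hq₀Θ, hΘU, hΘ⟩ := exists_straighten_commuting hU hq₀
    (fun i : Fin n => hΞ.smooth i.castSucc) (hΞ.rank q₀ hq₀) hΞ.commute
  have hso := Θ.toHomeo.open_source
  have hdiff : ∀ k, ∀ q ∈ Θ.toHomeo.source, DifferentiableAt ℝ (Ξ k) q := fun k q hq =>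
    ((hΞ.smooth k).contDiffAt (hU.mem_nhds (hΘU hq))).differentiableAt (by simp)
  set a : Base n m → (Fin n → ℝ) := fun q => (fderiv ℝ Θ.toHomeo q (Ξ (Fin.last n) q)).1
  have hda : ContDiffOn ℝ ∞ (fun q => fderiv ℝ Θ.toHomeo q (Ξ (Fin.last n) q))
      Θ.toHomeo.source :=
    (Θ.smooth.fderiv_of_isOpen hso (by simp)).clm_apply ((hΞ.smooth _).mono hΘU)
  -- the invariants of `Ξ_1, …, Ξ_n` are invariants of `Ξ_{n+1}`
  have hlast : ∀ q ∈ Θ.toHomeo.source, fderiv ℝ Θ.toHomeo q (Ξ (Fin.last n) q) = (a q, 0) := by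
    intro q hq
    refine Prod.ext rfl (funext fun α => ?_)
    have hα : ∀ q ∈ Θ.toHomeo.source, ∀ v, fderiv ℝ (fun q => (Θ.toHomeo q).2 α) q v =
        (fderiv ℝ Θ.toHomeo q v).2 α := by
      intro q hq v
      have h1 := hasFDerivAt_pi'.1 ((Θ.differentiableAt hq).hasFDerivAt.snd) α
      rw [h1.fderiv]
      rfl
    rw [← hα q hq]
    refine hΞ.invariant _ hΘU hso _ ?_ (fun i p hp => ?_) q hq
    · exact contDiffOn_pi.1 Θ.smooth.snd α
    · rw [hα p hp, hΘ p hp]; rfl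
  have hcomb : ∀ q ∈ Θ.toHomeo.source, Ξ (Fin.last n) q = ∑ i, a q i • Ξ i.castSucc q := by
    intro q hq
    apply Θ.fderiv_injective hq
    rw [hlast q hq, map_sum]
    simp only [map_smul, hΘ q hq]
    ext j
    · simp [Prod.fst_sum, Finset.sum_apply, Pi.single_apply]
    · simp [Prod.snd_sum, Finset.sum_apply]
  have hdai : ∀ q ∈ Θ.toHomeo.source, ∀ i : Fin n,
      fderiv ℝ (fun q => fderiv ℝ Θ.toHomeo q (Ξ (Fin.last n) q)) q (Ξ i.castSucc q)
        = (Pi.single i 1, 0) := by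
    intro q hq i
    have h1 := VectorField.fderiv_apply_lieBracket (V := Ξ i.castSucc) (W := Ξ (Fin.last n))
      (Θ.contDiffAt hq)
      (by rw [minSmoothness_of_isRCLikeNormedField]; exact WithTop.coe_le_coe.2 le_top)
      (hdiff _ q hq) (hdiff _ q hq)
    have h2 : (fun q => fderiv ℝ Θ.toHomeo q (Ξ i.castSucc q)) =ᶠ[𝓝 q]
        fun _ => (Pi.single i 1, 0) := by
      filter_upwards [hso.mem_nhds hq] with p hp using hΘ p hp i
    rw [hΞ.bracket_last i q (hΘU hq), hΘ q hq, h2.fderiv_eq] at h1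
    simpa using h1.symm
  set f : Base n m → Base n m := fun q => (a q, (Θ.toHomeo q).2) with hf
  have hfs : ContDiffOn ℝ ∞ f Θ.toHomeo.source := hda.fst.prodMk Θ.smooth.snd
  have hfd : ∀ q ∈ Θ.toHomeo.source, ∀ v, fderiv ℝ f q v =
      ((fderiv ℝ (fun q => fderiv ℝ Θ.toHomeo q (Ξ (Fin.last n) q)) q v).1,
        (fderiv ℝ Θ.toHomeo q v).2) := by
    intro q hq v
    have h1 := ((hda.contDiffAt (hso.mem_nhds hq)).differentiableAt (by simp)).hasFDerivAt
    have h2 : HasFDerivAt f _ q := h1.fst.prodMk (Θ.differentiableAt hq).hasFDerivAt.snd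
    rw [h2.fderiv]
    rfl
  have hfi : ∀ q ∈ Θ.toHomeo.source, ∀ i : Fin n,
      fderiv ℝ f q (Ξ i.castSucc q) = (Pi.single i 1, 0) := by
    intro q hq i
    rw [hfd q hq, hdai q hq i, hΘ q hq i]
  obtain ⟨Φ, h1, h2, h3⟩ := exists_pointTransformation hso hfs hq₀Θ
    ((injective_iff_map_eq_zero _).2 fun v hv => by
      have hv2 : (fderiv ℝ Θ.toHomeo q₀ v).2 = 0 := by
        have := congrArg Prod.snd hv
        rwa [hfd q₀ hq₀Θ] at this
      have hv' : v = ∑ i, (fderiv ℝ Θ.toHomeo q₀ v).1 i • Ξ i.castSucc q₀ := by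
        apply Θ.fderiv_injective hq₀Θ
        rw [map_sum]
        simp only [map_smul, hΘ q₀ hq₀Θ]
        ext j
        · simp [Prod.fst_sum, Finset.sum_apply, Pi.single_apply]
        · simp [Prod.snd_sum, Finset.sum_apply, hv2]
      have hc : (fderiv ℝ Θ.toHomeo q₀ v).1 = 0 := by
        have h1 := congrArg Prod.fst hv
        rw [hv', map_sum] at h1
        simp only [map_smul, hfi q₀ hq₀Θ] at h1
        refine Eq.trans ?_ h1
        ext j
        simp [Prod.fst_sum, Finset.sum_apply, Pi.single_apply]
      rw [hv', hc]
      simp)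
  refine ⟨Φ, h1, h2.trans hΘU, fun q hq => ⟨fun i => ?_, ?_⟩⟩
  · rw [h3, hfi q (h2 hq)]
  · rw [h3]
    conv_lhs => rw [hcomb q (h2 hq), map_sum]
    simp only [map_smul, hfi q (h2 hq)]
    ext j
    · simp [Prod.fst_sum, Finset.sum_apply, Pi.single_apply, hf]
    · simp [Prod.snd_sum, Finset.sum_apply]

end CanonicalVariables

/-! ### Straightened algebras and their regular jets -/

section StraightenedAlgebra

variable {n m : ℕ}

lemma sum_smul_single_prod (c : Fin n → ℝ) :
    ∑ i, c i • ((Pi.single i 1, 0) : Base n m) = (c, 0) := by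
  ext j
  · simp [Prod.fst_sum, Finset.sum_apply, Pi.single_apply]
  · simp [Prod.snd_sum, Finset.sum_apply]

namespace PointTransformation.Straightens

variable {Φ : PointTransformation n m} {Ξ : Fin (n + 1) → Base n m → Base n m}

lemma fderiv_sum (hΦ : Φ.Straightens Ξ) {q : Base n m} (hq : q ∈ Φ.toHomeo.source)
    (c : Fin n → ℝ) : fderiv ℝ Φ.toHomeo q (∑ i, c i • Ξ i.castSucc q) = (c, 0) := by
  simp only [map_sum, map_smul, (hΦ q hq).1, sum_smul_single_prod]

lemma fderiv_element (hΦ : Φ.Straightens Ξ) {q : Base n m} (hq : q ∈ Φ.toHomeo.source)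
    (c : Fin (n + 1) → ℝ) : fderiv ℝ Φ.toHomeo q (∑ k, c k • Ξ k q) =
      ((fun i : Fin n => c i.castSucc) + c (Fin.last n) • (Φ.toHomeo q).1, 0) := by
  rw [Fin.sum_univ_castSucc, map_add, hΦ.fderiv_sum hq fun i => c i.castSucc, map_smul, (hΦ q hq).2]
  simp

lemma mono {Ψ : PointTransformation n m} (hΦ : Φ.Straightens Ξ)
    (h : Ψ.toHomeo.source ⊆ Φ.toHomeo.source) (h' : ⇑Ψ.toHomeo = Φ.toHomeo) :
    Ψ.Straightens Ξ := fun q hq => by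
  rw [h']
  exact hΦ q (h hq)

/-- The regular jets of the algebra are those at which the canonical variables can be prolonged: in
these variables the linear part of the element `∑ (z_j - z_j(q)) ∂/∂z_j` that vanishes at `q` is the
projection to the `z`-directions. -/
theorem mem_regularJets_iff (hΦ : Φ.Straightens Ξ) {j : Jet n m} (hj : j.1 ∈ Φ.toHomeo.source)
    (hΞ : ∀ k, DifferentiableAt ℝ (Ξ k) j.1) : j ∈ regularJets Ξ ↔ ProlongableAt Φ.toHomeo j := by
  have hc : ∀ c : Fin n → ℝ, Ξ (Fin.last n) j.1 = ∑ i, c i • Ξ i.castSucc j.1 ↔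
      c = (Φ.toHomeo j.1).1 := by
    intro c
    rw [← (Φ.fderiv_injective hj).eq_iff, (hΦ _ hj).2, hΦ.fderiv_sum hj]
    simp [eq_comm]
  set z := (Φ.toHomeo j.1).1
  set Y : Base n m → Base n m :=
    fun q => Ξ (Fin.last n) q - ∑ i, z i • Ξ i.castSucc q with hY
  have hYd : DifferentiableAt ℝ Y j.1 :=
    (hΞ _).sub (DifferentiableAt.fun_sum fun i _ => (hΞ _).fun_const_smul _)
  have hY0 : Y j.1 = 0 := sub_eq_zero.2 ((hc z).2 rfl)
  have hlin : ∀ v, fderiv ℝ Φ.toHomeo j.1 (fderiv ℝ Y j.1 v)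
      = ((fderiv ℝ Φ.toHomeo j.1 v).1, 0) := by
    intro v
    have hΦd : DifferentiableAt ℝ (fderiv ℝ Φ.toHomeo) j.1 :=
      ((Φ.contDiffAt hj).fderiv_right (m := 1)
        (by rw [one_add_one_eq_two]; exact WithTop.coe_le_coe.2 le_top)).differentiableAt
          one_ne_zero
    have h1 := hΦd.hasFDerivAt.clm_apply hYd.hasFDerivAt
    have h2 : (fun q => fderiv ℝ Φ.toHomeo q (Y q)) =ᶠ[𝓝 j.1]
        fun q => ((Φ.toHomeo q).1 - z, 0) := by
      filter_upwards [Φ.toHomeo.open_source.mem_nhds hj] with q hq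
      rw [hY, map_sub, hΦ.fderiv_sum hq, (hΦ q hq).2]
      simp
    have h3 := ((Φ.differentiableAt hj).hasFDerivAt.fst.sub_const z).prodMk
      (hasFDerivAt_const (0 : Fin m → ℝ) j.1)
    have h4 := DFunLike.congr_fun (h1.unique (h3.congr_of_eventuallyEq h2)) v
    simpa [hY0] using h4
  have hker : ∀ v, fderiv ℝ Y j.1 (v, j.2.mulVec v) = 0 ↔
      (totalDeriv (fun q => (Φ.toHomeo q).1) j).mulVec v = 0 := by
    intro v
    rw [totalDeriv_mulVec, fderiv.fst (Φ.differentiableAt hj),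
      ← map_eq_zero_iff _ (Φ.fderiv_injective hj), hlin]
    simp
  have hreg : j ∈ regularJets Ξ ↔
      ∀ v, (totalDeriv (fun q => (Φ.toHomeo q).1) j).mulVec v = 0 → v = 0 := by
    simp only [regularJets, Set.mem_ofPred_eq, hc]
    rw [forall_eq]
    exact forall_congr' fun v => by rw [← hker]
  rw [hreg, ProlongableAt, ne_eq, ← Matrix.exists_mulVec_eq_zero_iff]
  push Not
  exact forall_congr' fun v => ⟨fun h hv hv' => hv (h hv'), fun h hv => by
    by_contra hne; exact h hne hv⟩

/-- Fields that are straightened in this way span an algebra of the required kind. -/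
theorem isReductionAlgebra (hn : 0 < n) (hΦ : Φ.Straightens Ξ) (hne : Φ.toHomeo.source.Nonempty)
    (hΞ : ∀ k, ContDiffOn ℝ ∞ (Ξ k) Φ.toHomeo.source) :
    IsReductionAlgebra Φ.toHomeo.source Ξ := by
  have hso := Φ.toHomeo.open_source
  have hdiff : ∀ k, ∀ q ∈ Φ.toHomeo.source, DifferentiableAt ℝ (Ξ k) q := fun k q hq =>
    ((hΞ k).contDiffAt (hso.mem_nhds hq)).differentiableAt (by simp)
  have hbr : ∀ k l, ∀ q ∈ Φ.toHomeo.source, fderiv ℝ Φ.toHomeo q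
      (VectorField.lieBracket ℝ (Ξ k) (Ξ l) q) =
        fderiv ℝ (fun q => fderiv ℝ Φ.toHomeo q (Ξ l q)) q (Ξ k q) -
          fderiv ℝ (fun q => fderiv ℝ Φ.toHomeo q (Ξ k q)) q (Ξ l q) := fun k l q hq =>
    VectorField.fderiv_apply_lieBracket (Φ.contDiffAt hq)
      (by rw [minSmoothness_of_isRCLikeNormedField]; exact WithTop.coe_le_coe.2 le_top)
      (hdiff _ q hq) (hdiff _ q hq)
  have hconst : ∀ i : Fin n, ∀ q ∈ Φ.toHomeo.source,
      fderiv ℝ (fun q => fderiv ℝ Φ.toHomeo q (Ξ i.castSucc q)) q = 0 := by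
    intro i q hq
    have : (fun q => fderiv ℝ Φ.toHomeo q (Ξ i.castSucc q)) =ᶠ[𝓝 q]
        fun _ => (Pi.single i 1, 0) := by
      filter_upwards [hso.mem_nhds hq] with p hp using (hΦ p hp).1 i
    rw [this.fderiv_eq]
    simp
  refine ⟨hΞ, ?_, fun q hq => ?_, fun i j q hq => ?_, fun i q hq => ?_,
    fun U' hU' _ f _ hf q hq => ?_⟩
  · rw [Fintype.linearIndependent_iff]
    intro g hg
    have h1 : ∀ q ∈ Φ.toHomeo.source,
        (fun i : Fin n => g i.castSucc) + g (Fin.last n) • (Φ.toHomeo q).1 = 0 := by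
      intro q hq
      have h2 : ∑ k, g k • Ξ k q = 0 := by
        have := congrFun hg ⟨q, hq⟩
        simpa [Finset.sum_apply] using this
      have := hΦ.fderiv_element hq g
      rw [h2, map_zero] at this
      exact (congrArg Prod.fst this).symm
    obtain ⟨q, hq⟩ := hne
    -- moving along `∂/∂z_i` inside the source shows that the coefficient of `Ξ_{n+1}` vanishes
    have hlast : g (Fin.last n) = 0 := by
      have hcont : ContinuousAt
          (fun t : ℝ => Φ.toHomeo q + t • ((Pi.single ⟨0, hn⟩ 1, 0) : Base n m)) 0 := by fun_prop
      have hmem : ∀ᶠ t in 𝓝 (0 : ℝ),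
          Φ.toHomeo q + t • ((Pi.single ⟨0, hn⟩ 1, 0) : Base n m) ∈ Φ.toHomeo.target :=
        hcont.eventually_mem (by
          simpa using Φ.toHomeo.open_target.mem_nhds (Φ.toHomeo.map_source hq))
      obtain ⟨t, ht, ht0⟩ := ((hmem.filter_mono nhdsWithin_le_nhds).and
        (self_mem_nhdsWithin (s := {(0 : ℝ)}ᶜ))).exists
      have e1 := congrFun (h1 _ (Φ.toHomeo.map_target ht)) ⟨0, hn⟩
      have e0 := congrFun (h1 _ hq) ⟨0, hn⟩
      rw [Φ.toHomeo.right_inv ht] at e1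
      simp at e1 e0
      have : g (Fin.last n) * t = 0 := by linarith
      exact (mul_eq_zero.1 this).resolve_right ht0
    intro k
    refine Fin.lastCases hlast (fun i => ?_) k
    simpa [hlast] using congrFun (h1 q hq) i
  · rw [Fintype.linearIndependent_iff]
    intro g hg i
    have := hΦ.fderiv_sum hq g
    rw [hg, map_zero] at this
    exact (congrFun (congrArg Prod.fst this) i).symm
  · apply Φ.fderiv_injective hq
    rw [hbr _ _ q hq, hconst i q hq, hconst j q hq]
    simp
  · apply Φ.fderiv_injective hq
    rw [hbr _ _ q hq, hconst i q hq, (hΦ q hq).1]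
    have h2 : (fun q => fderiv ℝ Φ.toHomeo q (Ξ (Fin.last n) q)) =ᶠ[𝓝 q]
        fun q => ((Φ.toHomeo q).1, 0) := by
      filter_upwards [hso.mem_nhds hq] with p hp using (hΦ p hp).2
    have h3 := (Φ.differentiableAt hq).hasFDerivAt.fst.prodMk
      (hasFDerivAt_const (0 : Fin m → ℝ) q)
    rw [h2.fderiv_eq, h3.fderiv]
    simp [(hΦ q hq).1]
  · have : Ξ (Fin.last n) q = ∑ i, (Φ.toHomeo q).1 i • Ξ i.castSucc q := by
      apply Φ.fderiv_injective (hU' hq)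
      rw [hΦ.fderiv_sum (hU' hq), (hΦ q (hU' hq)).2]
    rw [this, map_sum]
    simp [hf _ q hq]

end PointTransformation.Straightens

namespace PointTransformation

/-- The fields `∂/∂z_1, …, ∂/∂z_n, ∑ z_j ∂/∂z_j` in the variables `(z, w)` given by `Φ`. -/
noncomputable def canonicalFields (Φ : PointTransformation n m) :
    Fin (n + 1) → Base n m → Base n m :=
  Fin.lastCases (fun q => fderiv ℝ Φ.toHomeo.symm (Φ.toHomeo q) ((Φ.toHomeo q).1, 0))
    (fun i q => fderiv ℝ Φ.toHomeo.symm (Φ.toHomeo q) (Pi.single i 1, 0))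

lemma straightens_canonicalFields (Φ : PointTransformation n m) :
    Φ.Straightens Φ.canonicalFields := by
  intro q hq
  simp [canonicalFields, Φ.fderiv_fderiv_symm hq]

lemma contDiffOn_canonicalFields (Φ : PointTransformation n m) (k : Fin (n + 1)) :
    ContDiffOn ℝ ∞ (Φ.canonicalFields k) Φ.toHomeo.source := by
  have h : ContDiffOn ℝ ∞ (fun q => fderiv ℝ Φ.toHomeo.symm (Φ.toHomeo q)) Φ.toHomeo.source :=
    (Φ.smooth_symm.fderiv_of_isOpen Φ.toHomeo.open_target (by simp)).comp Φ.smooth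
      Φ.toHomeo.mapsTo
  refine Fin.lastCases ?_ (fun i => ?_) k
  · simp only [canonicalFields, Fin.lastCases_last]
    exact h.clm_apply (Φ.smooth.fst.prodMk contDiffOn_const)
  · simp only [canonicalFields, Fin.lastCases_castSucc]
    exact h.clm_apply contDiffOn_const

end PointTransformation

end StraightenedAlgebra

/-! ### Affine flows and local flows of the algebra -/

section AffineFlow

variable {n m : ℕ}

/-- The primitive `∫ s in 0..t, exp (μ s)`. -/
noncomputable def expPrimitive (μ t : ℝ) : ℝ := if μ = 0 then t else (Real.exp (μ * t) - 1) / μ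

lemma mul_expPrimitive (μ t : ℝ) : μ * expPrimitive μ t = Real.exp (μ * t) - 1 := by
  unfold expPrimitive
  split_ifs with h
  · simp [h]
  · field_simp

@[simp] lemma expPrimitive_zero_right (μ : ℝ) : expPrimitive μ 0 = 0 := by
  simp [expPrimitive]

lemma hasDerivAt_expPrimitive (μ t : ℝ) :
    HasDerivAt (expPrimitive μ) (Real.exp (μ * t)) t := by
  unfold expPrimitive
  split_ifs with h
  · simpa [h] using hasDerivAt_id' t
  · have := ((((hasDerivAt_id t).const_mul μ).exp).sub_const 1).div_const μ
    simpa [h] using this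

lemma contDiff_expPrimitive (μ : ℝ) : ContDiff ℝ ∞ (expPrimitive μ) := by
  unfold expPrimitive
  split_ifs with h
  · exact contDiff_id
  · fun_prop

/-- The flow of the vector field `∑ i, (c i + μ z_i) ∂/∂z_i`. -/
noncomputable def affineFlow (c : Fin n → ℝ) (μ t : ℝ) (y : Base n m) : Base n m :=
  (Real.exp (μ * t) • y.1 + expPrimitive μ t • c, y.2)

@[simp] lemma affineFlow_zero (c : Fin n → ℝ) (μ : ℝ) (y : Base n m) :
    affineFlow c μ 0 y = y := by
  simp [affineFlow]

lemma contDiff_affineFlow (c : Fin n → ℝ) (μ : ℝ) :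
    ContDiff ℝ ∞ fun p : ℝ × Base n m => affineFlow c μ p.1 p.2 := by
  have := contDiff_expPrimitive μ
  unfold affineFlow
  have h1 : ContDiff ℝ ∞ fun p : ℝ × Base n m => Real.exp (μ * p.1) := by fun_prop
  have h2 : ContDiff ℝ ∞ fun p : ℝ × Base n m => p.2.1 := by fun_prop
  refine ContDiff.prodMk (ContDiff.add ?_ ?_) (by fun_prop)
  · exact h1.smul h2
  · exact ContDiff.smul (this.comp contDiff_fst) contDiff_const

lemma contDiff_affineFlow_apply (c : Fin n → ℝ) (μ t : ℝ) :
    ContDiff ℝ ∞ (affineFlow (m := m) c μ t) :=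
  (contDiff_affineFlow c μ).comp (contDiff_const.prodMk contDiff_id)

lemma differentiableAt_affineFlow (c : Fin n → ℝ) (μ t : ℝ) (y : Base n m) :
    DifferentiableAt ℝ (affineFlow c μ t) y :=
  (contDiff_affineFlow_apply c μ t).differentiable (by simp) y

lemma hasDerivAt_affineFlow (c : Fin n → ℝ) (μ t : ℝ) (y : Base n m) :
    HasDerivAt (fun t => affineFlow c μ t y) (c + μ • (affineFlow c μ t y).1, 0) t := by
  have h1 : HasDerivAt (fun t => Real.exp (μ * t)) _ t := ((hasDerivAt_id' t).const_mul μ).exp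
  have h2 := ((h1.smul_const y.1).add ((hasDerivAt_expPrimitive μ t).smul_const c)).prodMk
    (hasDerivAt_const t y.2)
  refine HasDerivAt.congr_deriv h2 (Prod.ext ?_ rfl)
  simp only [affineFlow, smul_add, smul_smul, mul_expPrimitive]
  module

lemma affineFlow_inverse (c : Fin n → ℝ) (μ t : ℝ) (y : Base n m) :
    affineFlow c μ (-t) (affineFlow c μ t y) = y := by
  have h : Real.exp (μ * -t) * Real.exp (μ * t) = 1 := by rw [← Real.exp_add]; simp
  have h2 : Real.exp (μ * -t) * expPrimitive μ t + expPrimitive μ (-t) = 0 := by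
    by_cases h0 : μ = 0
    · simp [expPrimitive, h0]
    · apply mul_left_cancel₀ h0
      rw [mul_add, mul_left_comm, mul_expPrimitive, mul_expPrimitive, mul_sub, h]
      ring
  refine Prod.ext ?_ rfl
  simp only [affineFlow, smul_add, smul_smul, h, one_smul, add_assoc, ← add_smul, h2]
  simp

lemma affineFlow_inverse' (c : Fin n → ℝ) (μ t : ℝ) (y : Base n m) :
    affineFlow c μ t (affineFlow c μ (-t) y) = y := by
  simpa using affineFlow_inverse c μ (-t) y

lemma totalDeriv_affineFlow_fst (c : Fin n → ℝ) (μ t : ℝ) (j : Jet n m) :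
    totalDeriv (fun q => (affineFlow c μ t q).1) j = Real.exp (μ * t) • (1 : Matrix _ _ ℝ) := by
  rw [eq_totalDeriv_iff]
  intro v
  have : HasFDerivAt (fun q : Base n m => (affineFlow c μ t q).1)
      (Real.exp (μ * t) • ContinuousLinearMap.fst ℝ (Fin n → ℝ) (Fin m → ℝ)) j.1 :=
    (hasFDerivAt_fst.const_smul (Real.exp (μ * t))).add_const _
  rw [this.fderiv]
  simp [Matrix.smul_mulVec]

lemma totalDeriv_affineFlow_snd (c : Fin n → ℝ) (μ t : ℝ) (j : Jet n m) :
    totalDeriv (fun q => (affineFlow c μ t q).2) j = j.2 :=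
  totalDeriv_snd_id j

lemma prolongableAt_affineFlow (c : Fin n → ℝ) (μ t : ℝ) (j : Jet n m) :
    ProlongableAt (affineFlow c μ t) j := by
  simp [ProlongableAt, totalDeriv_affineFlow_fst]

lemma prolong_affineFlow (c : Fin n → ℝ) (μ t : ℝ) (j : Jet n m) :
    prolong (affineFlow c μ t) j = (affineFlow c μ t j.1, Real.exp (-(μ * t)) • j.2) := by
  refine Prod.ext rfl ?_
  simp only [prolong, totalDeriv_affineFlow_fst, totalDeriv_affineFlow_snd]
  have : (Real.exp (μ * t) • (1 : Matrix (Fin n) (Fin n) ℝ))⁻¹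
      = Real.exp (-(μ * t)) • (1 : Matrix (Fin n) (Fin n) ℝ) := by
    apply Matrix.inv_eq_left_inv
    rw [smul_mul_smul_comm, ← Real.exp_add]
    simp
  rw [this]
  simp

namespace PointTransformation.Straightens

variable {Φ : PointTransformation n m} {Ξ : Fin (n + 1) → Base n m → Base n m}

/-- In canonical variables the local flows of the elements of the algebra are affine. -/
theorem localFlow_eq (hΦ : Φ.Straightens Ξ) {c : Fin (n + 1) → ℝ} {U₀ : Set (Base n m)} {a b : ℝ}
    {φ : ℝ → Base n m → Base n m}
    (hφ : IsLocalFlow (fun q => ∑ k, c k • Ξ k q) Φ.toHomeo.source U₀ a b φ) {t : ℝ}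
    (ht : t ∈ Set.Ioo a b) {q : Base n m} (hq : q ∈ U₀) :
    Φ.toHomeo (φ t q) =
      affineFlow (fun i => c i.castSucc) (c (Fin.last n)) t (Φ.toHomeo q) := by
  set μ := c (Fin.last n)
  set L : Base n m →L[ℝ] Base n m :=
    μ • (ContinuousLinearMap.inl ℝ _ _).comp (ContinuousLinearMap.fst ℝ (Fin n → ℝ) (Fin m → ℝ))
    with hL
  set v : ℝ → Base n m → Base n m :=
    fun _ y => ((fun i : Fin n => c i.castSucc, 0) : Base n m) + L y
    with hv
  have hva : ∀ t y, v t y = ((fun i : Fin n => c i.castSucc) + μ • y.1, 0) := by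
    intro t y
    ext <;> simp [hv, hL]
  have hlip : ∀ t ∈ Set.Ioo a b, LipschitzOnWith ‖L‖₊ (v t) Set.univ := fun t _ =>
    ((LipschitzWith.of_dist_le_mul fun y y' => by
      simp only [hv, dist_add_left]
      exact L.lipschitz.dist_le_mul y y') : LipschitzWith ‖L‖₊ (v t)).lipschitzOnWith
  refine ODE_solution_unique_of_mem_Ioo (f := fun t => Φ.toHomeo (φ t q))
    (g := fun t => affineFlow (fun i => c i.castSucc) μ t (Φ.toHomeo q)) hlip ⟨hφ.neg, hφ.pos⟩
    (fun s hs => ⟨?_, trivial⟩) (fun s hs => ⟨?_, trivial⟩) ?_ ht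
  · have h1 := (Φ.differentiableAt (hφ.mem s hs q hq)).hasFDerivAt.comp_hasDerivAt s
      (hφ.deriv s hs q hq)
    rw [hΦ.fderiv_element (hφ.mem s hs q hq) c] at h1
    exact h1.congr_deriv (hva s _).symm
  · refine HasDerivAt.congr_deriv ?_ (hva s _).symm
    exact hasDerivAt_affineFlow _ _ _ _
  · simp [hφ.zero q hq]

/-- An affine motion inside the target that takes time `1` comes from a local flow. -/
theorem exists_localFlow (hΦ : Φ.Straightens Ξ) (c : Fin (n + 1) → ℝ) {q : Base n m}
    (hq : q ∈ Φ.toHomeo.source)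
    (hpath : ∀ t ∈ Set.Icc (0 : ℝ) 1,
      affineFlow (fun i => c i.castSucc) (c (Fin.last n)) t (Φ.toHomeo q) ∈ Φ.toHomeo.target) :
    ∃ (U₀ : Set (Base n m)) (a b : ℝ), q ∈ U₀ ∧ 1 ∈ Set.Ioo a b ∧
      IsLocalFlow (fun q => ∑ k, c k • Ξ k q) Φ.toHomeo.source U₀ a b
        fun t q => Φ.toHomeo.symm
          (affineFlow (fun i => c i.castSucc) (c (Fin.last n)) t (Φ.toHomeo q)) := by
  set A := affineFlow (m := m) (fun i : Fin n => c i.castSucc) (c (Fin.last n)) with hA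
  have hAs : ContDiff ℝ ∞ fun p : ℝ × Base n m => A p.1 p.2 := contDiff_affineFlow _ _
  have hin : ContDiffOn ℝ ∞ (fun p : ℝ × Base n m => A p.1 (Φ.toHomeo p.2))
      (Set.univ ×ˢ Φ.toHomeo.source) :=
    hAs.comp_contDiffOn (contDiffOn_fst.prodMk (Φ.smooth.comp contDiffOn_snd fun p hp => hp.2))
  have hopen : IsOpen ((Set.univ ×ˢ Φ.toHomeo.source) ∩
      (fun p : ℝ × Base n m => A p.1 (Φ.toHomeo p.2)) ⁻¹' Φ.toHomeo.target) :=
    hin.continuousOn.isOpen_inter_preimage (isOpen_univ.prod Φ.toHomeo.open_source)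
      Φ.toHomeo.open_target
  obtain ⟨u, U₀, hu, hU₀, hIu, hqU₀, huU⟩ := generalized_tube_lemma (s := Set.Icc (0 : ℝ) 1)
    isCompact_Icc (isCompact_singleton (x := q)) hopen (by
      rintro ⟨t, p⟩ ⟨ht, rfl⟩
      exact ⟨⟨trivial, hq⟩, hpath t ht⟩)
  obtain ⟨ε, hε, hεu⟩ := Metric.isOpen_iff.1 hu 0 (hIu (by simp))
  obtain ⟨δ, hδ, hδu⟩ := Metric.isOpen_iff.1 hu 1 (hIu (by simp))
  have hIoo : Set.Ioo (-ε) (1 + δ) ⊆ u := by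
    intro t ht
    rcases lt_or_ge t 0 with h | h
    · exact hεu (by rw [Metric.mem_ball, Real.dist_eq, abs_lt]; constructor <;> linarith [ht.1])
    rcases le_or_gt t 1 with h' | h'
    · exact hIu ⟨h, h'⟩
    · exact hδu (by rw [Metric.mem_ball, Real.dist_eq, abs_lt]; constructor <;> linarith [ht.2])
  have hmem : ∀ t ∈ Set.Ioo (-ε) (1 + δ), ∀ p ∈ U₀,
      p ∈ Φ.toHomeo.source ∧ A t (Φ.toHomeo p) ∈ Φ.toHomeo.target := fun t ht p hp =>
    ⟨(huU (Set.mk_mem_prod (hIoo ht) hp)).1.2, (huU (Set.mk_mem_prod (hIoo ht) hp)).2⟩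
  have h0 : (0 : ℝ) ∈ Set.Ioo (-ε) (1 + δ) := ⟨by linarith, by linarith⟩
  refine ⟨U₀, -ε, 1 + δ, hqU₀ rfl, ⟨by linarith, by linarith⟩, ?_⟩
  refine ⟨by linarith, by linarith, hU₀, fun p hp => (hmem 0 h0 p hp).1, ?_, fun p hp => ?_,
    fun t ht p hp => Φ.toHomeo.map_target (hmem t ht p hp).2, fun t ht p hp => ?_⟩
  · exact Φ.smooth_symm.comp (hin.mono fun r hr => ⟨trivial, (hmem r.1 hr.1 r.2 hr.2).1⟩)
      fun r hr => (hmem r.1 hr.1 r.2 hr.2).2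
  · simp only [hA, affineFlow_zero]
    exact Φ.toHomeo.left_inv (hmem 0 h0 p hp).1
  · have ht' := (hmem t ht p hp).2
    have h1 := (Φ.differentiableAt_symm ht').hasFDerivAt.comp_hasDerivAt t
      (hasDerivAt_affineFlow (fun i : Fin n => c i.castSucc) (c (Fin.last n)) t (Φ.toHomeo p))
    refine h1.congr_deriv ?_
    have h2 := hΦ.fderiv_element (Φ.toHomeo.map_target ht') c
    rw [Φ.toHomeo.right_inv ht'] at h2
    change fderiv ℝ Φ.toHomeo.symm (A t (Φ.toHomeo p))
      ((fun i : Fin n => c i.castSucc) + c (Fin.last n) • (A t (Φ.toHomeo p)).1, 0) = _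
    rw [← h2]
    have h3 := Φ.fderiv_symm_fderiv (Φ.toHomeo.map_target ht')
      (∑ k, c k • Ξ k (Φ.toHomeo.symm (A t (Φ.toHomeo p))))
    rw [Φ.toHomeo.right_inv ht'] at h3
    exact h3

/-- The symmetries of a system, in canonical variables: the affine motions map the jets of the
system to jets of the system, provided that they stay in the domain and that the original
variables can be prolonged at both ends. -/
theorem holdsAt_iff_of_isSymmetryOn (hΦ : Φ.Straightens Ξ) {Δ : PolySystem n m}
    {U : Set (Base n m)} {R : Set (Jet n m)} (hU : Φ.toHomeo.source ⊆ U)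
    (hR : ∀ j : Jet n m, j.1 ∈ Φ.toHomeo.source → ProlongableAt Φ.toHomeo j → j ∈ R)
    {c : Fin (n + 1) → ℝ} (hc : Δ.IsSymmetryOn U R fun q => ∑ k, c k • Ξ k q)
    {y : Base n m} {p : Matrix (Fin m) (Fin n) ℝ} (hy : y ∈ Φ.toHomeo.target)
    (hpath : ∀ t ∈ Set.Icc (0 : ℝ) 1,
      affineFlow (fun i => c i.castSucc) (c (Fin.last n)) t y ∈ Φ.toHomeo.target)
    (hp : ProlongableAt Φ.toHomeo.symm (y, p))
    (hp' : ProlongableAt Φ.toHomeo.symm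
      (affineFlow (fun i => c i.castSucc) (c (Fin.last n)) 1 y, Real.exp (-c (Fin.last n)) • p)) :
    Δ.HoldsAt (prolong Φ.toHomeo.symm (y, p)) ↔ Δ.HoldsAt (prolong Φ.toHomeo.symm
      (affineFlow (fun i => c i.castSucc) (c (Fin.last n)) 1 y,
        Real.exp (-c (Fin.last n)) • p)) := by
  set A := affineFlow (m := m) (fun i : Fin n => c i.castSucc) (c (Fin.last n)) with hA
  have hqs := Φ.toHomeo.map_target hy
  obtain ⟨hjp, hj⟩ := ProlongableAt.of_leftInverse (ψ := Φ.toHomeo) (j := (y, p))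
    (Φ.differentiableAt_symm hy) (Φ.differentiableAt hqs) hp
    (Φ.toHomeo.eventually_right_inverse hy)
  set j := prolong Φ.toHomeo.symm (y, p)
  have hΦj : Φ.toHomeo j.1 = y := Φ.toHomeo.right_inv hy
  obtain ⟨U₀, a, b, hqU₀, h1, hflow⟩ := hΦ.exists_localFlow c (q := Φ.toHomeo.symm y) hqs (by
    rwa [Φ.toHomeo.right_inv hy])
  have hflow' : IsLocalFlow (fun q => ∑ k, c k • Ξ k q) U U₀ a b _ :=
    { hflow with
      subset := hflow.subset.trans hU
      mem := fun t ht q hq => hU (hflow.mem t ht q hq) }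
  have hjs : j.1 ∈ Φ.toHomeo.source := hqs
  have hAt : A 1 y ∈ Φ.toHomeo.target := hpath 1 (by simp)
  have hd1 := Φ.differentiableAt hjs
  have hd2 : DifferentiableAt ℝ (A 1) (Φ.toHomeo j.1) := differentiableAt_affineFlow _ _ _ _
  have hd12 : DifferentiableAt ℝ (fun q => A 1 (Φ.toHomeo q)) j.1 := hd2.comp j.1 hd1
  have hd3 : DifferentiableAt ℝ Φ.toHomeo.symm (A 1 (Φ.toHomeo j.1)) := by
    rw [hΦj]; exact Φ.differentiableAt_symm hAt
  have hP : prolong (fun q => A 1 (Φ.toHomeo q)) j = (A 1 y, Real.exp (-c (Fin.last n)) • p) := by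
    rw [prolong_comp hd1 hd2 hjp, hj, hA, prolong_affineFlow, mul_one]
  have hP' : ProlongableAt (fun q => A 1 (Φ.toHomeo q)) j :=
    (prolongableAt_comp hd1 hd2 hjp).2 (prolongableAt_affineFlow _ _ _ _)
  have key := hc U₀ a b _ hflow' 1 h1 j (hR j hjs hjp) hqU₀
    ((prolongableAt_comp hd12 hd3 hP').2 (by rw [hP]; exact hp'))
  rw [prolong_comp hd12 hd3 hP', hP] at key
  exact key

end PointTransformation.Straightens

end AffineFlow

/-! ### Smooth families of polynomials -/

section SmoothFamily

variable {E σ : Type*} [NormedAddCommGroup E] [NormedSpace ℝ E]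

/-- The exponents of degree at most `N` form a finite set that is independent of the polynomial. -/
lemma subset_antidiag_of_totalDegree_le [Fintype σ] [DecidableEq σ] {P : MvPolynomial σ ℝ} {N : ℕ}
    (hN : P.totalDegree ≤ N) : P.support ⊆ (Finset.range (N + 1)).biUnion fun k =>
      Finset.finsuppAntidiag Finset.univ k := by
  intro d hd
  have h1 := (MvPolynomial.le_totalDegree hd).trans hN
  simp only [Finset.mem_biUnion, Finset.mem_range, Finset.mem_finsuppAntidiag]
  refine ⟨d.degree, Nat.lt_succ_of_le h1, ?_, Finset.subset_univ _⟩
  rw [Finsupp.degree_eq_sum]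

/-- A family of polynomials with smooth coefficients and bounded degrees. -/
def IsSmoothFamily (P : E → MvPolynomial σ ℝ) (s : Set E) : Prop :=
  (∀ d, ContDiffOn ℝ ∞ (fun q => (P q).coeff d) s) ∧ ∃ N : ℕ, ∀ q ∈ s, (P q).totalDegree ≤ N

namespace IsSmoothFamily

variable {P Q : E → MvPolynomial σ ℝ} {s : Set E}

lemma const (p : MvPolynomial σ ℝ) (s : Set E) : IsSmoothFamily (fun _ => p) s :=
  ⟨fun _ => contDiffOn_const, p.totalDegree, fun _ _ => le_rfl⟩

lemma C {f : E → ℝ} (hf : ContDiffOn ℝ ∞ f s) :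
    IsSmoothFamily (fun q => MvPolynomial.C (σ := σ) (f q)) s := by
  classical
  refine ⟨fun d => ?_, 0, fun q _ => by simp⟩
  simp only [MvPolynomial.coeff_C]
  split_ifs
  exacts [hf, contDiffOn_const]

lemma add (hP : IsSmoothFamily P s) (hQ : IsSmoothFamily Q s) :
    IsSmoothFamily (fun q => P q + Q q) s := by
  obtain ⟨hP, N, hN⟩ := hP
  obtain ⟨hQ, M, hM⟩ := hQ
  refine ⟨fun d => ?_, max N M, fun q hq => (MvPolynomial.totalDegree_add _ _).trans
    (max_le_max (hN q hq) (hM q hq))⟩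
  simpa only [MvPolynomial.coeff_add] using (hP d).add (hQ d)

lemma mul (hP : IsSmoothFamily P s) (hQ : IsSmoothFamily Q s) :
    IsSmoothFamily (fun q => P q * Q q) s := by
  classical
  obtain ⟨hP, N, hN⟩ := hP
  obtain ⟨hQ, M, hM⟩ := hQ
  refine ⟨fun d => ?_, N + M, fun q hq => (MvPolynomial.totalDegree_mul _ _).trans
    (add_le_add (hN q hq) (hM q hq))⟩
  simp only [MvPolynomial.coeff_mul]
  exact ContDiffOn.sum fun i _ => (hP _).mul (hQ _)

lemma sum {ι : Type*} (t : Finset ι) {P : ι → E → MvPolynomial σ ℝ}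
    (h : ∀ i ∈ t, IsSmoothFamily (P i) s) : IsSmoothFamily (fun q => ∑ i ∈ t, P i q) s := by
  classical
  induction t using Finset.induction_on with
  | empty => simpa using const 0 s
  | insert a t ha ih =>
    simp only [Finset.sum_insert ha]
    exact (h a (by simp)).add (ih fun i hi => h i (by simp [hi]))

lemma prod {ι : Type*} (t : Finset ι) {P : ι → E → MvPolynomial σ ℝ}
    (h : ∀ i ∈ t, IsSmoothFamily (P i) s) : IsSmoothFamily (fun q => ∏ i ∈ t, P i q) s := by
  classical
  induction t using Finset.induction_on with
  | empty => simpa using const 1 s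
  | insert a t ha ih =>
    simp only [Finset.prod_insert ha]
    exact (h a (by simp)).mul (ih fun i hi => h i (by simp [hi]))

lemma pow (hP : IsSmoothFamily P s) (k : ℕ) : IsSmoothFamily (fun q => P q ^ k) s := by
  simpa using prod (Finset.range k) fun _ _ => hP

lemma congr (hP : IsSmoothFamily P s) (h : ∀ q ∈ s, Q q = P q) : IsSmoothFamily Q s := by
  obtain ⟨hP, N, hN⟩ := hP
  exact ⟨fun d => (hP d).congr fun q hq => by rw [h q hq], N, fun q hq => by
    rw [h q hq]; exact hN q hq⟩

lemma mono {t : Set E} (hP : IsSmoothFamily P s) (h : t ⊆ s) : IsSmoothFamily P t :=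
  ⟨fun d => (hP.1 d).mono h, hP.2.imp fun _ hN q hq => hN q (h hq)⟩

lemma comp {E' : Type*} [NormedAddCommGroup E'] [NormedSpace ℝ E'] {t : Set E'} {f : E' → E}
    (hP : IsSmoothFamily P s) (hf : ContDiffOn ℝ ∞ f t) (hft : Set.MapsTo f t s) :
    IsSmoothFamily (fun q => P (f q)) t :=
  ⟨fun d => (hP.1 d).comp hf hft, hP.2.imp fun _ hN _ hq => hN _ (hft hq)⟩

lemma det {ι : Type*} [Fintype ι] [DecidableEq ι] {A : E → Matrix ι ι (MvPolynomial σ ℝ)}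
    (h : ∀ i j, IsSmoothFamily (fun q => A q i j) s) : IsSmoothFamily (fun q => (A q).det) s := by
  simp only [Matrix.det_apply']
  exact sum _ fun τ _ => (const _ s).mul (prod _ fun i _ => h _ _)

lemma adjugate {ι : Type*} [Fintype ι] [DecidableEq ι] {A : E → Matrix ι ι (MvPolynomial σ ℝ)}
    (h : ∀ i j, IsSmoothFamily (fun q => A q i j) s) (i j : ι) :
    IsSmoothFamily (fun q => (A q).adjugate i j) s := by
  simp only [Matrix.adjugate_apply]
  refine det fun k l => ?_
  simp only [Matrix.updateRow_apply]
  split_ifs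
  exacts [const _ s, h k l]

lemma homogeneousComponent (hP : IsSmoothFamily P s) (k : ℕ) :
    IsSmoothFamily (fun q => MvPolynomial.homogeneousComponent k (P q)) s := by
  refine ⟨fun d => ?_, k, fun q _ =>
    (MvPolynomial.homogeneousComponent_isHomogeneous k (P q)).totalDegree_le⟩
  simp only [MvPolynomial.coeff_homogeneousComponent]
  split_ifs
  exacts [hP.1 d, contDiffOn_const]

lemma bind₁ [Fintype σ] {τ : Type*} {f : E → σ → MvPolynomial τ ℝ} (hP : IsSmoothFamily P s)
    (hf : ∀ a, IsSmoothFamily (fun q => f q a) s) :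
    IsSmoothFamily (fun q => MvPolynomial.bind₁ (f q) (P q)) s := by
  classical
  obtain ⟨N, hN⟩ := hP.2
  refine (sum ((Finset.range (N + 1)).biUnion fun k => Finset.finsuppAntidiag Finset.univ k)
    (P := fun d q => MvPolynomial.C ((P q).coeff d) * ∏ a, f q a ^ d a) fun d _ =>
    (C (hP.1 d)).mul (prod _ fun a _ => (hf a).pow _)).congr fun q hq => ?_
  rw [MvPolynomial.bind₁, MvPolynomial.aeval_def, MvPolynomial.eval₂_eq']
  refine Finset.sum_subset (subset_antidiag_of_totalDegree_le (hN q hq)) fun d _ hd => ?_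
  rw [MvPolynomial.notMem_support_iff.1 hd]
  simp

end IsSmoothFamily

end SmoothFamily

section Evaluation

open MvPolynomial

variable {σ : Type*}

lemma eval_mul_of_isHomogeneous [Fintype σ] {P : MvPolynomial σ ℝ} {k : ℕ}
    (hP : P.IsHomogeneous k) (t : ℝ) (x : σ → ℝ) :
    eval (fun a => t * x a) P = t ^ k * eval x P := by
  rw [eval_eq', eval_eq', Finset.mul_sum]
  refine Finset.sum_congr rfl fun d hd => ?_
  have hdk : ∑ a, d a = k := by
    rw [← Finsupp.degree_eq_sum]
    by_contra hne
    exact (mem_support_iff.1 hd) (hP.coeff_eq_zero hne)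
  simp only [mul_pow, Finset.prod_mul_distrib, Finset.prod_pow_eq_pow_sum, hdk]
  ring

lemma eval_eq_sum_homogeneousComponent {P : MvPolynomial σ ℝ} {N : ℕ} (hN : P.totalDegree ≤ N)
    (x : σ → ℝ) : eval x P = ∑ k ∈ Finset.range (N + 1), eval x (homogeneousComponent k P) := by
  conv_lhs => rw [← sum_homogeneousComponent P, map_sum]
  refine Finset.sum_subset (Finset.range_mono (by omega)) fun k _ hk => ?_
  rw [homogeneousComponent_eq_zero _ _ (by
    have := not_lt.1 (mt Finset.mem_range.2 hk)
    omega), map_zero]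

/-- A polynomial that vanishes at infinitely many multiples of `x` has all its homogeneous
components vanish at `x`. -/
lemma eval_homogeneousComponent_eq_zero [Fintype σ] {P : MvPolynomial σ ℝ} {x : σ → ℝ} {S : Set ℝ}
    (hS : S.Infinite) (h : ∀ t ∈ S, eval (fun a => t * x a) P = 0) (k : ℕ) :
    eval x (homogeneousComponent k P) = 0 := by
  set p : Polynomial ℝ := ∑ k ∈ Finset.range (P.totalDegree + 1),
    Polynomial.monomial k (eval x (homogeneousComponent k P)) with hp
  have hp0 : p = 0 := by
    refine Polynomial.eq_zero_of_infinite_isRoot p (hS.mono fun t ht => ?_)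
    change p.eval t = 0
    rw [← h t ht, eval_eq_sum_homogeneousComponent le_rfl, hp, Polynomial.eval_finsetSum]
    refine Finset.sum_congr rfl fun k _ => ?_
    rw [eval_mul_of_isHomogeneous (homogeneousComponent_isHomogeneous k P),
      Polynomial.eval_monomial, mul_comm]
  by_cases hk : k < P.totalDegree + 1
  · have := congrArg (fun q => q.coeff k) hp0
    simpa [hp, Polynomial.finsetSum_coeff, Polynomial.coeff_monomial, hk] using this
  · rw [homogeneousComponent_eq_zero _ _ (by omega), map_zero]

/-- The polynomial `δ ^ (N + 1) * P (r / δ)`, for polynomials `r` and `δ`, where `N` is a bound for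
the degree of `P`. The exponent exceeds `N`, so that the polynomial vanishes where `δ` does. -/
noncomputable def clearDenominators {σ τ : Type*} (N : ℕ) (P : MvPolynomial σ ℝ)
    (r : σ → MvPolynomial τ ℝ) (δ : MvPolynomial τ ℝ) : MvPolynomial τ ℝ :=
  ∑ k ∈ Finset.range (N + 1), δ ^ (N + 1 - k) * bind₁ r (homogeneousComponent k P)

lemma eval_clearDenominators [Fintype σ] {τ : Type*} {N : ℕ} {P : MvPolynomial σ ℝ}
    (hN : P.totalDegree ≤ N) {r : σ → MvPolynomial τ ℝ} {δ : MvPolynomial τ ℝ} {x : τ → ℝ}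
    {y : σ → ℝ}
    (hy : ∀ a, eval x (r a) = eval x δ * y a) :
    eval x (clearDenominators N P r δ) = eval x δ ^ (N + 1) * eval y P := by
  rw [clearDenominators, map_sum, eval_eq_sum_homogeneousComponent hN, Finset.mul_sum]
  refine Finset.sum_congr rfl fun k hk => ?_
  have h1 : eval x (bind₁ r (homogeneousComponent k P))
      = eval x δ ^ k * eval y (homogeneousComponent k P) := by
    rw [← eval_mul_of_isHomogeneous (homogeneousComponent_isHomogeneous k P)]
    simp only [← hy]
    simpa only [aeval_eq_eval] using aeval_bind₁ x r (homogeneousComponent k P)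
  rw [map_mul, map_pow, h1, ← mul_assoc, ← pow_add]
  congr 2
  have := Finset.mem_range.1 hk
  omega

lemma eval_clearDenominators_eq_zero {σ τ : Type*} {N : ℕ} {P : MvPolynomial σ ℝ}
    {r : σ → MvPolynomial τ ℝ} {δ : MvPolynomial τ ℝ} {x : τ → ℝ} (hδ : eval x δ = 0) :
    eval x (clearDenominators N P r δ) = 0 := by
  rw [clearDenominators, map_sum]
  refine Finset.sum_eq_zero fun k hk => ?_
  have := Finset.mem_range.1 hk
  rw [map_mul, map_pow, hδ, zero_pow (by omega), zero_mul]

lemma IsSmoothFamily.clearDenominators [Fintype σ] {E τ : Type*} [NormedAddCommGroup E]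
    [NormedSpace ℝ E] {s : Set E} {P : E → MvPolynomial σ ℝ} {r : E → σ → MvPolynomial τ ℝ}
    {δ : E → MvPolynomial τ ℝ} (hP : IsSmoothFamily P s)
    (hr : ∀ a, IsSmoothFamily (fun q => r q a) s) (hδ : IsSmoothFamily δ s) (N : ℕ) :
    IsSmoothFamily (fun q => _root_.clearDenominators N (P q) (r q) (δ q)) s :=
  IsSmoothFamily.sum _ fun k _ => (hδ.pow _).mul ((hP.homogeneousComponent k).bind₁ hr)

/-- A homogeneous polynomial whose nonzero real zeros are the common zeros of the homogeneous
components of degree at most `N` of `P`: a sum of their squares, brought to the common degree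
`2 * (N + 1)` by powers of the squared norm. -/
noncomputable def sumSqComponents [Fintype σ] (N : ℕ) (P : MvPolynomial σ ℝ) : MvPolynomial σ ℝ :=
  ∑ k ∈ Finset.range (N + 1), homogeneousComponent k P ^ 2 * (∑ a, X a ^ 2) ^ (N + 1 - k)

lemma isHomogeneous_sumSqComponents [Fintype σ] (N : ℕ) (P : MvPolynomial σ ℝ) :
    (sumSqComponents N P).IsHomogeneous (2 * (N + 1)) := by
  refine IsHomogeneous.sum _ _ _ fun k hk => ?_
  have h1 := (homogeneousComponent_isHomogeneous k P).pow 2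
  have h2 : (∑ a : σ, X a ^ 2 : MvPolynomial σ ℝ).IsHomogeneous 2 :=
    IsHomogeneous.sum _ _ _ fun a _ => isHomogeneous_X_pow a 2
  have h3 := h1.mul (h2.pow (N + 1 - k))
  have := Finset.mem_range.1 hk
  convert h3 using 1
  omega

lemma eval_sumSqComponents [Fintype σ] (N : ℕ) (P : MvPolynomial σ ℝ) (x : σ → ℝ) :
    eval x (sumSqComponents N P) = ∑ k ∈ Finset.range (N + 1),
      eval x (homogeneousComponent k P) ^ 2 * (∑ a, x a ^ 2) ^ (N + 1 - k) := by
  simp [sumSqComponents]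

lemma eval_sumSqComponents_nonneg [Fintype σ] (N : ℕ) (P : MvPolynomial σ ℝ) (x : σ → ℝ) :
    0 ≤ eval x (sumSqComponents N P) := by
  rw [eval_sumSqComponents]
  positivity

lemma eval_sumSqComponents_eq_zero_iff [Fintype σ] {N : ℕ} {P : MvPolynomial σ ℝ}
    (hN : P.totalDegree ≤ N) {x : σ → ℝ} (hx : x ≠ 0) :
    eval x (sumSqComponents N P) = 0 ↔ ∀ k, eval x (homogeneousComponent k P) = 0 := by
  have hpos : 0 < ∑ a, x a ^ 2 := by
    obtain ⟨a, ha⟩ := Function.ne_iff.1 hx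
    exact Finset.sum_pos' (fun _ _ => sq_nonneg _) ⟨a, Finset.mem_univ _, by
      have : x a ≠ 0 := ha
      positivity⟩
  rw [eval_sumSqComponents, Finset.sum_eq_zero_iff_of_nonneg fun k _ => by positivity]
  refine ⟨fun h k => ?_, fun h k _ => by rw [h k]; simp⟩
  by_cases hk : k < N + 1
  · have := h k (Finset.mem_range.2 hk)
    simpa [hpos.ne'] using this
  · rw [homogeneousComponent_eq_zero _ _ (by omega), map_zero]

lemma IsSmoothFamily.sumSqComponents [Fintype σ] {E : Type*} [NormedAddCommGroup E]
    [NormedSpace ℝ E] {s : Set E} {P : E → MvPolynomial σ ℝ} (hP : IsSmoothFamily P s) (N : ℕ) :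
    IsSmoothFamily (fun q => _root_.sumSqComponents N (P q)) s :=
  IsSmoothFamily.sum _ fun k _ => ((hP.homogeneousComponent k).pow 2).mul
    (IsSmoothFamily.const _ s)

/-- The values of a smooth family depend continuously on the parameter and on the point. -/
lemma IsSmoothFamily.continuousOn_eval_prod [Fintype σ] {E : Type*} [NormedAddCommGroup E]
    [NormedSpace ℝ E] {s : Set E} {P : E → MvPolynomial σ ℝ} (hP : IsSmoothFamily P s) :
    ContinuousOn (fun y : E × (σ → ℝ) => eval y.2 (P y.1)) (s ×ˢ Set.univ) := by
  classical
  obtain ⟨N, hN⟩ := hP.2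
  have h : ContinuousOn (fun y : E × (σ → ℝ) => ∑ d ∈ (Finset.range (N + 1)).biUnion fun k =>
      Finset.finsuppAntidiag Finset.univ k, (P y.1).coeff d * ∏ a, y.2 a ^ d a)
      (s ×ˢ Set.univ) := by
    refine continuousOn_finsetSum _ fun d _ => ContinuousOn.mul ?_ (by fun_prop)
    exact (hP.1 d).continuousOn.comp continuousOn_fst fun y hy => hy.1
  refine h.congr fun y hy => ?_
  simp only [eval_eq']
  refine Finset.sum_subset (subset_antidiag_of_totalDegree_le (hN _ hy.1)) fun d _ hd => ?_
  rw [notMem_support_iff.1 hd, zero_mul]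

lemma IsSmoothFamily.continuousOn_eval [Fintype σ] {E : Type*} [NormedAddCommGroup E]
    [NormedSpace ℝ E] {s : Set E} {P : E → MvPolynomial σ ℝ} (hP : IsSmoothFamily P s)
    (x : σ → ℝ) : ContinuousOn (fun q => eval x (P q)) s :=
  hP.continuousOn_eval_prod.comp (f := fun q => (q, x)) (by fun_prop) fun _ hq => ⟨hq, trivial⟩

end Evaluation

/-! ### Averaging over the new independent variables -/

section Averaging

open MeasureTheory

variable {n m : ℕ} {z₀ : Fin n → ℝ} (χ : ContDiffBump z₀) {R : ℝ}

lemma eventually_bump_eq_zero {z : Fin n → ℝ} (hR : χ.rOut < R) (hz : z ∉ Metric.ball z₀ R) :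
    ∀ᶠ z' in 𝓝 z, χ z' = 0 := by
  have : z ∈ (Metric.closedBall z₀ χ.rOut)ᶜ := fun h =>
    hz (Metric.closedBall_subset_ball hR h)
  filter_upwards [Metric.isClosed_closedBall.isOpen_compl.mem_nhds this] with z' hz'
  exact χ.zero_of_le_dist (not_le.1 fun h => hz' h).le

lemma continuous_bump_mul (hR : χ.rOut < R) {h : (Fin n → ℝ) → ℝ}
    (hh : ContinuousOn h (Metric.ball z₀ R)) : Continuous fun z => χ z * h z := by
  refine continuous_iff_continuousAt.2 fun z => ?_
  by_cases hz : z ∈ Metric.ball z₀ R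
  · exact χ.continuous.continuousAt.mul (hh.continuousAt (Metric.isOpen_ball.mem_nhds hz))
  · refine (continuousAt_const (y := (0 : ℝ))).congr ?_
    filter_upwards [eventually_bump_eq_zero χ hR hz] with z' hz'
    rw [hz', zero_mul]

lemma integrable_bump_mul (hR : χ.rOut < R) {h : (Fin n → ℝ) → ℝ}
    (hh : ContinuousOn h (Metric.ball z₀ R)) : Integrable fun z => χ z * h z :=
  (continuous_bump_mul χ hR hh).integrable_of_hasCompactSupport χ.hasCompactSupport.mul_right

/-- Averages over `z` of smooth functions of `(z, w)` are smooth in `w`. The function has to be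
smooth on a larger ball than the support of `χ`, so that the integrand is smooth in all `z`. -/
theorem contDiffOn_integral_bump_mul (hR : χ.rOut < R) {W : Set (Fin m → ℝ)} (hW : IsOpen W)
    {g : Base n m → ℝ} (hg : ContDiffOn ℝ ∞ g (Metric.ball z₀ R ×ˢ W)) :
    ContDiffOn ℝ ∞ (fun w => ∫ z, χ z * g (z, w)) W := by
  -- the average is the value at `0` of the convolution of `1` with the reflected integrand
  have key := contDiffOn_convolution_right_with_param_comp (μ := (volume : Measure (Fin n → ℝ)))
    (n := ⊤) (ContinuousLinearMap.mul ℝ ℝ) (s := W) (v := fun _ => (0 : Fin n → ℝ))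
    contDiffOn_const (f := fun _ => (1 : ℝ)) (g := fun w z => χ (-z) * g (-z, w))
    (k := (fun z => -z) '' Metric.closedBall z₀ χ.rOut) hW
    ((isCompact_closedBall _ _).image continuous_neg) (fun w z _ hz => ?_)
    (continuous_const.locallyIntegrable) ?_
  · refine key.congr fun w _ => ?_
    simp [convolution]
  · have : -z ∉ Metric.closedBall z₀ χ.rOut := fun h => hz ⟨-z, h, by simp⟩
    rw [χ.zero_of_le_dist (not_le.1 fun h => this h).le, zero_mul]
  · rintro ⟨w, z⟩ ⟨hw, -⟩
    apply ContDiffAt.contDiffWithinAt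
    have hneg : ContinuousAt (fun p : (Fin m → ℝ) × (Fin n → ℝ) => -p.2) (w, z) := by fun_prop
    by_cases hz : -z ∈ Metric.ball z₀ R
    · have h1 : ContDiffAt ℝ ∞ g (-z, w) :=
        hg.contDiffAt ((Metric.isOpen_ball.prod hW).mem_nhds ⟨hz, hw⟩)
      have h2 : ContDiffAt ℝ ∞ (fun p : (Fin m → ℝ) × (Fin n → ℝ) => g (-p.2, p.1)) (w, z) :=
        ContDiffAt.comp (w, z) (g := g) (f := fun p : (Fin m → ℝ) × (Fin n → ℝ) => (-p.2, p.1)) h1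
          (by fun_prop)
      have h3 : ContDiffAt ℝ ∞ (fun p : (Fin m → ℝ) × (Fin n → ℝ) => χ (-p.2)) (w, z) :=
        χ.contDiff.contDiffAt.comp (w, z) (by fun_prop)
      exact h3.mul h2
    · refine (contDiffAt_const (c := (0 : ℝ))).congr_of_eventuallyEq ?_
      filter_upwards [hneg.eventually (eventually_bump_eq_zero χ hR hz)] with p hp
      change χ (-p.2) * g (-p.2, p.1) = 0
      rw [hp, zero_mul]

open MvPolynomial

variable {σ : Type*} [Fintype σ] [DecidableEq σ]

/-- The average over `z`, with the weight `χ`, of a family of polynomials that are homogeneous of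
degree `D`. It is formed coefficientwise. -/
noncomputable def averagedPolynomial (D : ℕ) (G : Base n m → MvPolynomial σ ℝ) (w : Fin m → ℝ) :
    MvPolynomial σ ℝ :=
  ∑ d ∈ Finset.finsuppAntidiag Finset.univ D, monomial d (∫ z, χ z * (G (z, w)).coeff d)

lemma isHomogeneous_averagedPolynomial (D : ℕ) (G : Base n m → MvPolynomial σ ℝ)
    (w : Fin m → ℝ) : (averagedPolynomial χ D G w).IsHomogeneous D := by
  refine IsHomogeneous.sum _ _ _ fun d hd => isHomogeneous_monomial _ ?_
  rw [Finsupp.degree_eq_sum]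
  exact (Finset.mem_finsuppAntidiag.1 hd).1

lemma contDiffOn_coeff_averagedPolynomial (D : ℕ) (hR : χ.rOut < R) {W : Set (Fin m → ℝ)}
    (hW : IsOpen W) {G : Base n m → MvPolynomial σ ℝ}
    (hG : IsSmoothFamily G (Metric.ball z₀ R ×ˢ W)) (d : σ →₀ ℕ) :
    ContDiffOn ℝ ∞ (fun w => (averagedPolynomial χ D G w).coeff d) W := by
  simp only [averagedPolynomial, coeff_sum, coeff_monomial]
  refine ContDiffOn.sum fun e _ => ?_
  split_ifs
  exacts [contDiffOn_integral_bump_mul χ hR hW (hG.1 e), contDiffOn_const]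

lemma eval_averagedPolynomial {D : ℕ} (hR : χ.rOut < R) {W : Set (Fin m → ℝ)}
    {G : Base n m → MvPolynomial σ ℝ} (hG : IsSmoothFamily G (Metric.ball z₀ R ×ˢ W))
    (hD : ∀ y, (G y).IsHomogeneous D) {w : Fin m → ℝ} (hw : w ∈ W) (x : σ → ℝ) :
    eval x (averagedPolynomial χ D G w) = ∫ z, χ z * eval x (G (z, w)) := by
  have hcont : ∀ d, ContinuousOn (fun z => (G (z, w)).coeff d) (Metric.ball z₀ R) := fun d =>
    (hG.1 d).continuousOn.comp (f := fun z => (z, w)) (by fun_prop) fun z hz => ⟨hz, hw⟩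
  have hev : ∀ z, χ z * eval x (G (z, w)) = ∑ d ∈ Finset.finsuppAntidiag Finset.univ D,
      (χ z * (G (z, w)).coeff d) * ∏ a, x a ^ d a := by
    intro z
    rw [eval_eq', Finset.mul_sum]
    simp only [← mul_assoc]
    refine Finset.sum_subset (fun d hd => ?_) fun d _ hd => ?_
    · refine Finset.mem_finsuppAntidiag.2 ⟨?_, Finset.subset_univ _⟩
      rw [← Finsupp.degree_eq_sum]
      by_contra hne
      exact (mem_support_iff.1 hd) ((hD _).coeff_eq_zero hne)
    · rw [notMem_support_iff.1 hd]
      simp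
  simp only [hev]
  rw [integral_finsetSum _ fun d _ => (integrable_bump_mul χ hR (hcont d)).mul_const _]
  simp only [averagedPolynomial, map_sum, eval_monomial, integral_mul_const]
  refine Finset.sum_congr rfl fun d _ => ?_
  rw [Finsupp.prod_fintype _ _ fun _ => pow_zero _]

lemma integral_bump_mul_eq_zero_iff (hR : χ.rOut < R) {h : (Fin n → ℝ) → ℝ}
    (hh : ContinuousOn h (Metric.ball z₀ R)) (h0 : ∀ z, 0 ≤ h z) :
    ∫ z, χ z * h z = 0 ↔ ∀ z ∈ Metric.ball z₀ χ.rOut, h z = 0 := by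
  have hc := continuous_bump_mul χ hR hh
  have hnn : ∀ z, 0 ≤ χ z * h z := fun z => mul_nonneg χ.nonneg (h0 z)
  constructor
  · intro hi z hz
    have hpos : 0 < χ z := χ.pos_of_mem_ball hz
    by_contra hne
    refine (hc.integral_pos_of_hasCompactSupport_nonneg_nonzero χ.hasCompactSupport.mul_right hnn
      (x := z) (mul_ne_zero hpos.ne' hne)).ne' hi
  · intro hz
    have : (fun z => χ z * h z) = fun _ => 0 := by
      funext z
      by_cases hz' : z ∈ Metric.ball z₀ χ.rOut
      · rw [hz z hz', mul_zero]
      · rw [χ.zero_of_le_dist (not_lt.1 fun h => hz' h), zero_mul]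
    rw [this]
    simp

/-- A family of polynomials in `p`, smooth in `(z, w)`, can be replaced by a family of homogeneous
polynomials that are smooth in `w` and whose nonzero zeros are those `p` at which the homogeneous
components of all the members of the family vanish, for all `z`. -/
theorem exists_homogeneous_of_isSmoothFamily {r : ℝ} (hr : 0 < r) {W : Set (Fin m → ℝ)}
    (hW : IsOpen W) {F : Base n m → MvPolynomial σ ℝ}
    (hF : IsSmoothFamily F (Metric.ball z₀ (2 * r) ×ˢ W)) :
    ∃ (N : ℕ) (Q : (Fin m → ℝ) → MvPolynomial σ ℝ), 1 ≤ N ∧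
      (∀ d, ContDiffOn ℝ ∞ (fun w => (Q w).coeff d) W) ∧ (∀ w, (Q w).IsHomogeneous N) ∧
      ∀ w ∈ W, ∀ x ≠ 0, (eval x (Q w) = 0 ↔
        ∀ z ∈ Metric.ball z₀ r, ∀ k, eval x (homogeneousComponent k (F (z, w))) = 0) := by
  obtain ⟨N, hN⟩ := hF.2
  let χ : ContDiffBump z₀ := ⟨r / 2, r, by positivity, by linarith⟩
  have hχ : χ.rOut < 2 * r := by change r < 2 * r; linarith
  have hG := hF.sumSqComponents N
  refine ⟨2 * (N + 1), averagedPolynomial χ (2 * (N + 1)) fun y => sumSqComponents N (F y),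
    by omega, contDiffOn_coeff_averagedPolynomial χ _ hχ hW hG,
    fun w => isHomogeneous_averagedPolynomial χ _ _ w, fun w hw x hx => ?_⟩
  have hcont : ContinuousOn (fun z => eval x (sumSqComponents N (F (z, w))))
      (Metric.ball z₀ (2 * r)) :=
    (hG.continuousOn_eval x).comp (f := fun z => (z, w)) (by fun_prop) fun z hz => ⟨hz, hw⟩
  rw [eval_averagedPolynomial χ hχ hG (fun y => isHomogeneous_sumSqComponents N _) hw,
    integral_bump_mul_eq_zero_iff χ hχ hcont fun z => eval_sumSqComponents_nonneg _ _ _]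
  refine forall₂_congr fun z hz => ?_
  exact eval_sumSqComponents_eq_zero_iff
    (hN _ ⟨Metric.ball_subset_ball hχ.le hz, hw⟩) hx

end Averaging

/-! ### Prolongation as a polynomial substitution -/

section PolynomialProlongation

variable {n m k : ℕ}

/-- The total derivatives of `F` at `y`, as polynomials in the derivatives `p`. -/
noncomputable def totalDerivPoly (F : Base n m → (Fin k → ℝ)) (y : Base n m) :
    Matrix (Fin k) (Fin n) (MvPolynomial (Fin m × Fin n) ℝ) :=
  Matrix.of fun a i => MvPolynomial.C (fderiv ℝ F y (Pi.single i 1, 0) a) +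
    ∑ α, MvPolynomial.C (fderiv ℝ F y (0, Pi.single α 1) a) * MvPolynomial.X (α, i)

lemma eval_totalDerivPoly (F : Base n m → (Fin k → ℝ)) (y : Base n m)
    (p : Matrix (Fin m) (Fin n) ℝ) :
    (totalDerivPoly F y).map (MvPolynomial.eval fun a : Fin m × Fin n => p a.1 a.2) =
      totalDeriv F (y, p) := by
  ext a i
  have h : ((Pi.single i 1, fun α => p α i) : Base n m) =
      (Pi.single i 1, 0) + ∑ α, p α i • ((0, Pi.single α 1) : Base n m) := by
    ext b
    · simp [Prod.fst_sum]
    · simp [Prod.snd_sum, Finset.sum_apply, Pi.single_apply]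
  simp only [totalDeriv, Matrix.of_apply, h, map_add, map_sum, map_smul]
  simp [totalDerivPoly, Finset.sum_apply, mul_comm]

lemma isSmoothFamily_totalDerivPoly {F : Base n m → (Fin k → ℝ)} {s : Set (Base n m)}
    (hs : IsOpen s) (hF : ContDiffOn ℝ ∞ F s) (a : Fin k) (i : Fin n) :
    IsSmoothFamily (fun y => totalDerivPoly F y a i) s := by
  have h : ∀ v : Base n m, ContDiffOn ℝ ∞ (fun y => fderiv ℝ F y v a) s := fun v =>
    contDiffOn_pi.1 ((hF.fderiv_of_isOpen hs (by simp)).clm_apply contDiffOn_const) a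
  exact (IsSmoothFamily.C (h _)).add (IsSmoothFamily.sum _ fun α _ =>
    (IsSmoothFamily.C (h _)).mul (IsSmoothFamily.const _ s))

/-- The polynomial in the new derivatives that is obtained from the polynomial `P q` at `q = Ψ y`
by substituting the prolongation of `Ψ` and clearing the denominators. -/
noncomputable def pullbackPoly (N : ℕ) (P : Base n m → MvPolynomial (Fin m × Fin n) ℝ)
    (Ψ : Base n m → Base n m) (y : Base n m) : MvPolynomial (Fin m × Fin n) ℝ :=
  clearDenominators N (P (Ψ y))
    (fun a => (totalDerivPoly (fun q => (Ψ q).2) y *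
      (totalDerivPoly (fun q => (Ψ q).1) y).adjugate) a.1 a.2)
    (totalDerivPoly (fun q => (Ψ q).1) y).det

lemma eval_det_totalDerivPoly (F : Base n m → (Fin n → ℝ)) (y : Base n m)
    (p : Matrix (Fin m) (Fin n) ℝ) :
    MvPolynomial.eval (fun a : Fin m × Fin n => p a.1 a.2) (totalDerivPoly F y).det =
      (totalDeriv F (y, p)).det := by
  rw [RingHom.map_det, RingHom.mapMatrix_apply, eval_totalDerivPoly]

/-- By Cramer's rule, `p' = D_x W * adj (D_x Z) / det D_x Z`. -/
lemma eval_pullbackPoly {N : ℕ} {P : Base n m → MvPolynomial (Fin m × Fin n) ℝ}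
    {Ψ : Base n m → Base n m} {y : Base n m} (hN : (P (Ψ y)).totalDegree ≤ N)
    {p : Matrix (Fin m) (Fin n) ℝ} (hp : ProlongableAt Ψ (y, p)) :
    MvPolynomial.eval (fun a : Fin m × Fin n => p a.1 a.2) (pullbackPoly N P Ψ y) = 0 ↔
      MvPolynomial.eval (fun a : Fin m × Fin n => (prolong Ψ (y, p)).2 a.1 a.2) (P (Ψ y)) = 0 := by
  rw [pullbackPoly, eval_clearDenominators hN
    (y := fun a : Fin m × Fin n => (prolong Ψ (y, p)).2 a.1 a.2), eval_det_totalDerivPoly]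
  · simp [show (totalDeriv (fun q => (Ψ q).1) (y, p)).det ≠ 0 from hp]
  · rintro ⟨α, i⟩
    have h1 := congrFun (congrFun (Matrix.map_mul (L := totalDerivPoly (fun q => (Ψ q).2) y)
      (M := (totalDerivPoly (fun q => (Ψ q).1) y).adjugate)
      (f := MvPolynomial.eval fun a : Fin m × Fin n => p a.1 a.2)) α) i
    rw [Matrix.map_apply] at h1
    have h2 : ((totalDerivPoly (fun q => (Ψ q).1) y).adjugate).map
        (MvPolynomial.eval fun a : Fin m × Fin n => p a.1 a.2) =
          (totalDeriv (fun q => (Ψ q).1) (y, p)).adjugate := by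
      rw [← eval_totalDerivPoly]
      exact RingHom.map_adjugate _ _
    have h3 : (totalDerivPoly (fun q => (Ψ q).2) y).map
        (MvPolynomial.eval fun a : Fin m × Fin n => p a.1 a.2) =
          totalDeriv (fun q => (Ψ q).2) (y, p) := eval_totalDerivPoly _ _ _
    rw [h2, h3] at h1
    rw [h1, eval_det_totalDerivPoly]
    simp only [prolong, Matrix.inv_def, Ring.inverse_eq_inv', Matrix.mul_smul, Matrix.smul_apply,
      smul_eq_mul]
    rw [mul_inv_cancel_left₀ hp]

/-- Jets at which `Ψ` cannot be prolonged are zeros, because `clearDenominators` leaves a factor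
`det D_x Z`. -/
lemma eval_pullbackPoly_eq_zero {N : ℕ} {P : Base n m → MvPolynomial (Fin m × Fin n) ℝ}
    {Ψ : Base n m → Base n m} {y : Base n m} {p : Matrix (Fin m) (Fin n) ℝ}
    (hp : ¬ ProlongableAt Ψ (y, p)) :
    MvPolynomial.eval (fun a : Fin m × Fin n => p a.1 a.2) (pullbackPoly N P Ψ y) = 0 := by
  refine eval_clearDenominators_eq_zero ?_
  rw [eval_det_totalDerivPoly]
  exact not_not.1 hp

lemma IsSmoothFamily.pullbackPoly {P : Base n m → MvPolynomial (Fin m × Fin n) ℝ}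
    {Ψ : Base n m → Base n m} {s t : Set (Base n m)} (hP : IsSmoothFamily P s) (ht : IsOpen t)
    (hΨ : ContDiffOn ℝ ∞ Ψ t) (hts : Set.MapsTo Ψ t s) (N : ℕ) :
    IsSmoothFamily (_root_.pullbackPoly N P Ψ) t := by
  have h1 : ∀ a i, IsSmoothFamily (fun y => totalDerivPoly (fun q => (Ψ q).1) y a i) t :=
    isSmoothFamily_totalDerivPoly ht hΨ.fst
  refine (hP.comp hΨ hts).clearDenominators (fun a => ?_) (IsSmoothFamily.det h1) N
  simp only [Matrix.mul_apply]
  exact IsSmoothFamily.sum _ fun i _ =>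
    (isSmoothFamily_totalDerivPoly ht hΨ.snd _ _).mul (IsSmoothFamily.adjugate h1 _ _)

end PolynomialProlongation

/-! ### Reduction by canonical variables -/

section Reduction

variable {n m : ℕ}

namespace PointTransformation

lemma prolong_symm_prolong (Φ : PointTransformation n m) {j : Jet n m}
    (hj : j.1 ∈ Φ.toHomeo.source) (hp : ProlongableAt Φ.toHomeo j) :
    ProlongableAt Φ.toHomeo.symm (prolong Φ.toHomeo j) ∧
      prolong Φ.toHomeo.symm (prolong Φ.toHomeo j) = j :=
  hp.of_leftInverse (Φ.differentiableAt hj) (Φ.differentiableAt_symm (Φ.toHomeo.map_source hj))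
    (Φ.toHomeo.eventually_left_inverse hj)

end PointTransformation

/-- In canonical variables on a product with convex first factor, the homogeneous components of the
transformed equations vanish at all points with the same invariants, as soon as the derivatives
are those of a jet of the system at one of them: the dilations take care of the components and the
translations of the points. -/
theorem eval_homogeneousComponent_pullbackPoly_eq_zero {Δ : PolySystem n m} {U : Set (Base n m)}
    {Ξ : Fin (n + 1) → Base n m → Base n m} {R : Set (Jet n m)}
    (hsymm : ∀ c : Fin (n + 1) → ℝ, Δ.IsSymmetryOn U R fun q => ∑ k, c k • Ξ k q)
    {Φ : PointTransformation n m} (hΦ : Φ.Straightens Ξ) (hU : Φ.toHomeo.source ⊆ U)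
    (hR : ∀ j : Jet n m, j.1 ∈ Φ.toHomeo.source → ProlongableAt Φ.toHomeo j → j ∈ R)
    {B : Set (Fin n → ℝ)} (hB : Convex ℝ B) {W : Set (Fin m → ℝ)}
    (htarget : Φ.toHomeo.target = B ×ˢ W) {N : Fin m → ℕ}
    (hN : ∀ s, ∀ q ∈ Φ.toHomeo.source, (Δ s q).totalDegree ≤ N s)
    {z : Fin n → ℝ} (hz : z ∈ B) {w : Fin m → ℝ} (hw : w ∈ W) {p : Matrix (Fin m) (Fin n) ℝ}
    (hp : ProlongableAt Φ.toHomeo.symm ((z, w), p))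
    (hΔ : Δ.HoldsAt (prolong Φ.toHomeo.symm ((z, w), p))) (s : Fin m) {z' : Fin n → ℝ}
    (hz' : z' ∈ B) (k : ℕ) :
    MvPolynomial.eval (fun a : Fin m × Fin n => p a.1 a.2) (MvPolynomial.homogeneousComponent k
      (pullbackPoly (N s) (Δ s) Φ.toHomeo.symm (z', w))) = 0 := by
  have hmem : ∀ z ∈ B, (z, w) ∈ Φ.toHomeo.target := fun z hz => by
    rw [htarget]; exact ⟨hz, hw⟩
  -- for `t` near `1`, the dilations map `p` to derivatives `t • p` at which `Φ⁻¹` is prolongable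
  have hev : ∀ᶠ t in 𝓝 (1 : ℝ), 0 < t ∧ ProlongableAt Φ.toHomeo.symm ((z, w), t • p) := by
    have h1 := eventually_prolongableAt
      ((Φ.contDiffAt_symm (hmem z hz)).of_le (WithTop.coe_le_coe.2 le_top)) hp
    have h2 : ContinuousAt (fun t : ℝ => (((z, w), t • p) : Jet n m)) 1 := by fun_prop
    rw [ContinuousAt, one_smul] at h2
    exact (lt_mem_nhds one_pos).and (h2.eventually h1)
  have hinf : {t : ℝ | 0 < t ∧ ProlongableAt Φ.toHomeo.symm ((z, w), t • p)}.Infinite :=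
    infinite_of_mem_nhds 1 hev
  refine eval_homogeneousComponent_eq_zero hinf (fun t ht => ?_) k
  obtain ⟨ht0, htp⟩ := ht
  change MvPolynomial.eval (fun a : Fin m × Fin n => (t • p) a.1 a.2) _ = 0
  by_cases hp' : ProlongableAt Φ.toHomeo.symm ((z', w), t • p)
  swap
  · exact eval_pullbackPoly_eq_zero hp'
  rw [eval_pullbackPoly (hN s _ (Φ.toHomeo.map_target (hmem z' hz'))) hp']
  -- the field `-log t • ∑ (z_j - z_j₀) ∂/∂z_j`, where `z₀` is the given point, fixes that point and
  -- multiplies the derivatives by `t` at time `1`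
  have hdil : Δ.HoldsAt (prolong Φ.toHomeo.symm ((z, w), t • p)) := by
    set c : Fin (n + 1) → ℝ := Fin.lastCases (-Real.log t) fun i => Real.log t * z i with hc
    have h1 : ∀ τ, affineFlow (fun i => c i.castSucc) (c (Fin.last n)) τ (z, w) = (z, w) := by
      intro τ
      have h2 : (fun i : Fin n => c i.castSucc) = (-c (Fin.last n)) • z := by
        funext i
        simp [hc]
      rw [h2]
      refine Prod.ext ?_ rfl
      simp only [affineFlow, smul_smul, ← add_smul]
      rw [mul_neg, mul_comm (expPrimitive _ _), mul_expPrimitive]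
      simp
    have h3 : Real.exp (-c (Fin.last n)) = t := by
      simp [hc, Real.exp_log ht0]
    have h4 := (hΦ.holdsAt_iff_of_isSymmetryOn hU hR (hsymm c) (y := (z, w)) (p := p)
      (hmem z hz) (fun τ _ => by rw [h1]; exact hmem z hz) hp (by rw [h1, h3]; exact htp)).1 hΔ
    rwa [h1, h3] at h4
  -- the translation from `z` to `z'` does not change the derivatives
  have htrans : Δ.HoldsAt (prolong Φ.toHomeo.symm ((z', w), t • p)) := by
    set c : Fin (n + 1) → ℝ := Fin.lastCases 0 fun i => z' i - z i with hc
    have h0 : c (Fin.last n) = 0 := by simp [hc]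
    have h1 : ∀ τ, affineFlow (fun i => c i.castSucc) (c (Fin.last n)) τ (z, w)
        = (z + τ • (z' - z), w) := by
      intro τ
      refine Prod.ext ?_ rfl
      have h2 : (fun i : Fin n => c i.castSucc) = z' - z := by
        funext i
        simp [hc]
      simp [affineFlow, h0, h2, expPrimitive]
    have h1' : affineFlow (fun i => c i.castSucc) (c (Fin.last n)) 1 (z, w) = (z', w) := by
      rw [h1, one_smul, add_sub_cancel]
    have h3 : Real.exp (-c (Fin.last n)) • t • p = t • p := by simp [h0]
    have h4 := (hΦ.holdsAt_iff_of_isSymmetryOn hU hR (hsymm c) (y := (z, w)) (p := t • p)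
      (hmem z hz) (fun τ hτ => by
        rw [h1]
        exact hmem _ (hB.add_smul_sub_mem hz hz' hτ)) htp (by rw [h1', h3]; exact hp')).1 hdil
    rwa [h1', h3] at h4
  exact htrans s

/-- Canonical variables of the algebra reduce the system, once they are restricted to a product
`B × W` of balls. A jet satisfies the system iff the homogeneous components of the transformed
equations vanish at its derivatives for all `z` in `B`, and this is a homogeneous system in `w`. -/
theorem PolySystem.AdmitsAlgebra.exists_isReducedBy {Δ : PolySystem n m} {U : Set (Base n m)}
    (hU : IsOpen U) {q₀ : Base n m} (hΔ : Δ.IsSmoothOn U) {Ξ : Fin (n + 1) → Base n m → Base n m}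
    (hA : Δ.AdmitsAlgebra U (regularJets Ξ) Ξ) {Φ : PointTransformation n m}
    (hq₀ : q₀ ∈ Φ.toHomeo.source) (hΦU : Φ.toHomeo.source ⊆ U) (hΦ : Φ.Straightens Ξ) :
    ∃ Φ' : PointTransformation n m, q₀ ∈ Φ'.toHomeo.source ∧ Φ'.toHomeo.source ⊆ U ∧
      Φ'.Straightens Ξ ∧ Δ.IsReducedBy Φ' := by
  classical
  obtain ⟨ε, hε, hεt⟩ := Metric.isOpen_iff.1 Φ.toHomeo.open_target (Φ.toHomeo q₀)
    (Φ.toHomeo.map_source hq₀)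
  set z₀ := (Φ.toHomeo q₀).1 with hz₀
  set W := Metric.ball (Φ.toHomeo q₀).2 ε with hW
  have hball : Metric.ball z₀ ε ×ˢ W ⊆ Φ.toHomeo.target := by
    rw [hW, hz₀, ball_prod_same]; exact hεt
  set r := ε / 2 with hr
  have hr0 : 0 < r := by positivity
  have h2r : 2 * r = ε := by rw [hr]; ring
  set B := Metric.ball z₀ r
  have hBball : B ⊆ Metric.ball z₀ (2 * r) := Metric.ball_subset_ball (by linarith)
  have hBW : B ×ˢ W ⊆ Φ.toHomeo.target :=
    (Set.prod_mono (by rw [← h2r]; exact hBball) le_rfl).trans hball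
  have hopen : IsOpen (B ×ˢ W) := Metric.isOpen_ball.prod Metric.isOpen_ball
  set Φ' : PointTransformation n m := (Φ.symm.restrict (B ×ˢ W) hopen).symm
  have hcoe : ⇑Φ'.toHomeo = Φ.toHomeo := rfl
  have hcoe' : ⇑Φ'.toHomeo.symm = Φ.toHomeo.symm := rfl
  have htarget : Φ'.toHomeo.target = B ×ˢ W := by
    change Φ.toHomeo.target ∩ B ×ˢ W = B ×ˢ W
    exact Set.inter_eq_right.2 hBW
  have hsub : Φ'.toHomeo.source ⊆ Φ.toHomeo.source := by
    intro q hq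
    have := Φ.toHomeo.map_target (hBW (htarget ▸ Φ'.toHomeo.map_source hq))
    rwa [← hcoe', Φ'.toHomeo.left_inv hq] at this
  have hq₀' : q₀ ∈ Φ'.toHomeo.source := by
    have h1 : Φ.toHomeo q₀ ∈ Φ'.toHomeo.target := by
      rw [htarget]; exact ⟨Metric.mem_ball_self hr0, Metric.mem_ball_self hε⟩
    have h2 := Φ'.toHomeo.map_target h1
    rwa [hcoe', Φ.toHomeo.left_inv hq₀] at h2
  have hΦ's : Φ'.Straightens Ξ := hΦ.mono hsub hcoe
  have hdiff : ∀ k, ∀ q ∈ U, DifferentiableAt ℝ (Ξ k) q := fun k q hq =>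
    ((hA.algebra.smooth k).contDiffAt (hU.mem_nhds hq)).differentiableAt (by simp)
  have hreg : ∀ j : Jet n m, j.1 ∈ Φ'.toHomeo.source →
      (j ∈ regularJets Ξ ↔ ProlongableAt Φ'.toHomeo j) := fun j hj =>
    hΦ's.mem_regularJets_iff hj fun k => hdiff k _ (hΦU (hsub hj))
  have hΔs : ∀ s, IsSmoothFamily (Δ s) U := hΔ
  choose N hN using fun s => (hΔs s).2
  have hF : ∀ s, IsSmoothFamily (pullbackPoly (N s) (Δ s) Φ'.toHomeo.symm)
      (Metric.ball z₀ (2 * r) ×ˢ W) := fun s =>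
    (hΔs s).pullbackPoly (Metric.isOpen_ball.prod Metric.isOpen_ball)
      (by rw [h2r]; exact Φ.smooth_symm.mono hball)
      (fun y hy => hΦU (Φ.toHomeo.map_target (hball (h2r ▸ hy)))) (N s)
  choose D Q hD hQs hQh hQ using fun s => exists_homogeneous_of_isSmoothFamily hr0
    Metric.isOpen_ball (hF s)
  have key := fun (z : Fin n → ℝ) (hz : z ∈ B) (w : Fin m → ℝ) (hw : w ∈ W)
      (p : Matrix (Fin m) (Fin n) ℝ) (hp : ProlongableAt Φ'.toHomeo.symm ((z, w), p))
      (hpΔ : Δ.HoldsAt (prolong Φ'.toHomeo.symm ((z, w), p))) =>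
    eval_homogeneousComponent_pullbackPoly_eq_zero hA.symmetry hΦ's (hsub.trans hΦU)
      (fun j hj hjp => (hreg j hj).2 hjp) (convex_ball z₀ r) htarget
      (fun s q hq => hN s q (hΦU (hsub hq))) hz hw hp hpΔ
  -- conversely, if all the components vanish, then the jet satisfies the system
  have hconv : ∀ y ∈ B ×ˢ W, ∀ p, ProlongableAt Φ'.toHomeo.symm (y, p) →
      (∀ s k, MvPolynomial.eval (fun a : Fin m × Fin n => p a.1 a.2)
        (MvPolynomial.homogeneousComponent k
          (pullbackPoly (N s) (Δ s) Φ'.toHomeo.symm y)) = 0) →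
        Δ.HoldsAt (prolong Φ'.toHomeo.symm (y, p)) := by
    intro y hy p hp h s
    have hyU : Φ'.toHomeo.symm y ∈ U :=
      hΦU (hsub (Φ'.toHomeo.map_target (by rw [htarget]; exact hy)))
    change MvPolynomial.eval _ (Δ s (Φ'.toHomeo.symm y)) = 0
    rw [← eval_pullbackPoly (hN s _ hyU) hp, eval_eq_sum_homogeneousComponent le_rfl]
    exact Finset.sum_eq_zero fun k _ => h s k
  have hregular : ∀ q ∈ Φ'.toHomeo.source, ∃ p, Δ.HoldsAt (q, p) ∧
      ProlongableAt Φ'.toHomeo (q, p) := fun q hq => by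
    obtain ⟨p, hp, hp'⟩ := hA.regular q (hΦU (hsub hq))
    exact ⟨p, hp, (hreg (q, p) hq).1 hp'⟩
  have main : ∀ y ∈ B ×ˢ W, ∀ p, ProlongableAt Φ'.toHomeo.symm (y, p) →
      (Δ.HoldsAt (prolong Φ'.toHomeo.symm (y, p)) ↔
        ∀ s, MvPolynomial.eval (fun a : Fin m × Fin n => p a.1 a.2) (Q s y.2) = 0) := by
    rintro ⟨z, w⟩ ⟨hz, hw⟩ p hp
    by_cases hp0 : (fun a : Fin m × Fin n => p a.1 a.2) = 0
    · -- at `p = 0` both sides hold; on the left because of the jet that exists over each point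
      have hzero : ∀ {P : MvPolynomial (Fin m × Fin n) ℝ} {k : ℕ}, P.IsHomogeneous k → k ≠ 0 →
          MvPolynomial.eval (fun a : Fin m × Fin n => p a.1 a.2) P = 0 := by
        intro P k hP hk
        have h1 := eval_mul_of_isHomogeneous hP 0 (fun a : Fin m × Fin n => p a.1 a.2)
        rw [zero_pow hk, zero_mul] at h1
        rw [← h1]
        congr 1
        simp [hp0]
      refine iff_of_true (hconv (z, w) ⟨hz, hw⟩ p hp fun s k => ?_) fun s =>
        hzero (hQh s w) (by have := hD s; omega)
      rcases eq_or_ne k 0 with rfl | hk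
      · have hyt : ((z, w) : Base n m) ∈ Φ'.toHomeo.target := by rw [htarget]; exact ⟨hz, hw⟩
        obtain ⟨p₁, hp₁, hp₁'⟩ := hregular _ (Φ'.toHomeo.map_target hyt)
        obtain ⟨h1, h2⟩ := Φ'.prolong_symm_prolong (j := (Φ'.toHomeo.symm (z, w), p₁))
          (Φ'.toHomeo.map_target hyt) hp₁'
        set p₂ := (prolong Φ'.toHomeo (Φ'.toHomeo.symm (z, w), p₁)).2
        have h3 : prolong Φ'.toHomeo (Φ'.toHomeo.symm (z, w), p₁) = ((z, w), p₂) :=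
          Prod.ext (Φ'.toHomeo.right_inv hyt) rfl
        rw [h3] at h1 h2
        have h4 := key z hz w hw p₂ h1 (by rw [h2]; exact hp₁) s hz 0
        rw [MvPolynomial.homogeneousComponent_zero, MvPolynomial.eval_C] at h4 ⊢
        exact h4
      · exact hzero (MvPolynomial.homogeneousComponent_isHomogeneous k _) hk
    · constructor
      · intro h s
        exact (hQ s w hw _ hp0).2 fun z' hz' k => key z hz w hw p hp h s hz' k
      · intro h
        exact hconv (z, w) ⟨hz, hw⟩ p hp fun s k => (hQ s w hw _ hp0).1 (h s) z hz k
  have hsnd : Prod.snd '' Φ'.toHomeo.target ⊆ W := by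
    rw [htarget]
    rintro _ ⟨y, hy, rfl⟩
    exact hy.2
  refine ⟨Φ', hq₀', hsub.trans hΦU, hΦ's, ⟨D, Q, hD, fun s d => (hQs s d).mono hsnd,
    fun s w _ => hQh s w, fun j hj hjp => ?_⟩, hregular⟩
  obtain ⟨h1, h2⟩ := Φ'.prolong_symm_prolong hj hjp
  have h3 := main (prolong Φ'.toHomeo j).1 (htarget ▸ Φ'.toHomeo.map_source hj)
    (prolong Φ'.toHomeo j).2 h1
  rw [Prod.mk.eta, h2] at h3
  exact h3

end Reduction

/-! ### Symmetries of a reduced system -/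

section ReducedSystem

variable {n m : ℕ}

section LocalFlow

variable {Y : Base n m → Base n m} {U U₀ : Set (Base n m)} {a b : ℝ}
  {φ : ℝ → Base n m → Base n m}

lemma IsLocalFlow.contDiffAt (hφ : IsLocalFlow Y U U₀ a b φ) {t : ℝ} (ht : t ∈ Set.Ioo a b)
    {q : Base n m} (hq : q ∈ U₀) : ContDiffAt ℝ ∞ (φ t) q :=
  (hφ.smooth.contDiffAt ((isOpen_Ioo.prod hφ.isOpen).mem_nhds ⟨ht, hq⟩)).comp q
    (f := fun q => (t, q)) (by fun_prop)

end LocalFlow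

lemma totalDeriv_affineFlow_comp_fst (c : Fin n → ℝ) (μ t : ℝ) {φ : Base n m → Base n m}
    {j : Jet n m} (hφ : DifferentiableAt ℝ φ j.1) :
    totalDeriv (fun q => (affineFlow c μ t (φ q)).1) j =
      Real.exp (μ * t) • totalDeriv (fun q => (φ q).1) j := by
  rw [eq_totalDeriv_iff]
  intro v
  have h1 : HasFDerivAt (fun q => (affineFlow c μ t (φ q)).1) _ j.1 :=
    (hφ.hasFDerivAt.fst.const_smul (Real.exp (μ * t))).add_const (expPrimitive μ t • c)
  rw [h1.fderiv, Matrix.smul_mulVec, totalDeriv_mulVec, hφ.hasFDerivAt.fst.fderiv]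
  rfl

lemma prolongableAt_affineFlow_comp (c : Fin n → ℝ) (μ t : ℝ) {φ : Base n m → Base n m}
    {j : Jet n m} (hφ : DifferentiableAt ℝ φ j.1) :
    ProlongableAt (fun q => affineFlow c μ t (φ q)) j ↔ ProlongableAt φ j := by
  unfold ProlongableAt
  rw [totalDeriv_affineFlow_comp_fst c μ t hφ, Matrix.det_smul]
  simp

namespace PointTransformation.Straightens

variable {Φ : PointTransformation n m} {Ξ : Fin (n + 1) → Base n m → Base n m}
  {c : Fin (n + 1) → ℝ} {U₀ : Set (Base n m)} {a b : ℝ} {φ : ℝ → Base n m → Base n m}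

lemma localFlow_eventuallyEq (hΦ : Φ.Straightens Ξ)
    (hφ : IsLocalFlow (fun q => ∑ k, c k • Ξ k q) Φ.toHomeo.source U₀ a b φ) {t : ℝ}
    (ht : t ∈ Set.Ioo a b) {q : Base n m} (hq : q ∈ U₀) :
    (fun q => Φ.toHomeo (φ t q)) =ᶠ[𝓝 q] fun q =>
      affineFlow (fun i => c i.castSucc) (c (Fin.last n)) t (Φ.toHomeo q) := by
  filter_upwards [hφ.isOpen.mem_nhds hq] with p hp using hΦ.localFlow_eq hφ ht hp

/-- The local flows of the algebra map the jets at which `Φ` is prolongable to each other. -/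
lemma prolongableAt_prolong_localFlow_iff (hΦ : Φ.Straightens Ξ)
    (hφ : IsLocalFlow (fun q => ∑ k, c k • Ξ k q) Φ.toHomeo.source U₀ a b φ) {t : ℝ}
    (ht : t ∈ Set.Ioo a b) {j : Jet n m} (hj : j.1 ∈ U₀) (hjp : ProlongableAt (φ t) j) :
    ProlongableAt Φ.toHomeo (prolong (φ t) j) ↔ ProlongableAt Φ.toHomeo j := by
  rw [← prolongableAt_comp ((hφ.contDiffAt ht hj).differentiableAt (by simp))
    (Φ.differentiableAt (hφ.mem t ht _ hj)) hjp,
    prolongableAt_congr (hΦ.localFlow_eventuallyEq hφ ht hj),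
    prolongableAt_affineFlow_comp _ _ _ (Φ.differentiableAt (hφ.subset hj))]

/-- In canonical variables the prolonged local flows of the algebra are translations and
dilations. -/
lemma prolong_prolong_localFlow (hΦ : Φ.Straightens Ξ)
    (hφ : IsLocalFlow (fun q => ∑ k, c k • Ξ k q) Φ.toHomeo.source U₀ a b φ) {t : ℝ}
    (ht : t ∈ Set.Ioo a b) {j : Jet n m} (hj : j.1 ∈ U₀) (hjp : ProlongableAt (φ t) j)
    (hjΦ : ProlongableAt Φ.toHomeo j) :
    prolong Φ.toHomeo (prolong (φ t) j) =
      (affineFlow (fun i => c i.castSucc) (c (Fin.last n)) t (Φ.toHomeo j.1),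
        Real.exp (-(c (Fin.last n) * t)) • (prolong Φ.toHomeo j).2) := by
  rw [← prolong_comp ((hφ.contDiffAt ht hj).differentiableAt (by simp))
    (Φ.differentiableAt (hφ.mem t ht _ hj)) hjp,
    prolong_congr (hΦ.localFlow_eventuallyEq hφ ht hj),
    prolong_comp (Φ.differentiableAt (hφ.subset hj)) (differentiableAt_affineFlow _ _ _ _) hjΦ,
    prolong_affineFlow]
  rfl

/-- Autonomous homogeneous equations admit the translations and the dilations of `z`. -/
theorem isSymmetryOn_of_isReducedBy (hΦ : Φ.Straightens Ξ) {Δ : PolySystem n m}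
    (hΔ : Δ.IsReducedBy Φ) {R : Set (Jet n m)}
    (hR : ∀ j ∈ R, j.1 ∈ Φ.toHomeo.source → ProlongableAt Φ.toHomeo j)
    (c : Fin (n + 1) → ℝ) :
    Δ.IsSymmetryOn Φ.toHomeo.source R fun q => ∑ k, c k • Ξ k q := by
  intro U₀ a b φ hφ t ht j hjR hj hjp
  obtain ⟨⟨N, Q, -, -, hQ, hΔQ⟩, -⟩ := hΔ
  have hjs := hφ.subset hj
  have hjΦ := hR j hjR hjs
  rw [hΔQ j hjs hjΦ, hΔQ (prolong (φ t) j) (hφ.mem t ht _ hj)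
    ((hΦ.prolongableAt_prolong_localFlow_iff hφ ht hj hjp).2 hjΦ),
    hΦ.prolong_prolong_localFlow hφ ht hj hjp hjΦ]
  refine forall_congr' fun s => ?_
  have h1 := eval_mul_of_isHomogeneous
    (hQ s (Φ.toHomeo j.1).2 ⟨_, Φ.toHomeo.map_source hjs, rfl⟩) (Real.exp (-(c (Fin.last n) * t)))
    (fun a : Fin m × Fin n => (prolong Φ.toHomeo j).2 a.1 a.2)
  change _ ↔ MvPolynomial.eval (fun a : Fin m × Fin n =>
    Real.exp (-(c (Fin.last n) * t)) * (prolong Φ.toHomeo j).2 a.1 a.2) (Q s (Φ.toHomeo j.1).2) = 0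
  rw [h1, mul_eq_zero, or_iff_right (pow_ne_zero _ (Real.exp_ne_zero _))]
  rfl

end PointTransformation.Straightens

/-- The variety of a smooth system is closed. -/
lemma PolySystem.holdsAt_of_frequently {Δ : PolySystem n m} {Ω : Set (Base n m)} (hΩ : IsOpen Ω)
    (hΔ : Δ.IsSmoothOn Ω) {j : Jet n m} (hj : j.1 ∈ Ω) (h : ∃ᶠ j' in 𝓝 j, Δ.HoldsAt j') :
    Δ.HoldsAt j := by
  intro s
  have hs : IsSmoothFamily (Δ s) Ω := hΔ s
  have h1 : ContinuousAt (fun j : Jet n m =>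
      MvPolynomial.eval (fun a : Fin m × Fin n => j.2 a.1 a.2) (Δ s j.1)) j := by
    refine ContinuousAt.comp (f := fun j : Jet n m => (j.1, fun a : Fin m × Fin n => j.2 a.1 a.2))
      (g := fun y : Base n m × (Fin m × Fin n → ℝ) => MvPolynomial.eval y.2 (Δ s y.1)) ?_ ?_
    · exact hs.continuousOn_eval_prod.continuousAt ((hΩ.prod isOpen_univ).mem_nhds ⟨hj, trivial⟩)
    · fun_prop
  by_contra hne
  exact h ((h1.eventually_ne hne).mono fun j' hj' hh => hj' (hh s))

/-- If the jets at which `Φ` is prolongable are dense in the variety of the system, then the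
symmetries on those jets are symmetries on all jets: the prolonged transformations and their local
inverses are continuous, and the variety is closed. -/
theorem PointTransformation.Straightens.isSymmetryOn_univ {Φ : PointTransformation n m}
    {Ξ : Fin (n + 1) → Base n m → Base n m} (hΦ : Φ.Straightens Ξ) {Δ : PolySystem n m}
    {R : Set (Jet n m)}
    (hR : ∀ j : Jet n m, j.1 ∈ Φ.toHomeo.source → ProlongableAt Φ.toHomeo j → j ∈ R)
    (hΔ : Δ.IsSmoothOn Φ.toHomeo.source)
    (hdense : Δ.variety Φ.toHomeo.source ⊆
      closure (Δ.variety Φ.toHomeo.source ∩ {j | ProlongableAt Φ.toHomeo j}))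
    {c : Fin (n + 1) → ℝ}
    (hc : Δ.IsSymmetryOn Φ.toHomeo.source R fun q => ∑ k, c k • Ξ k q) :
    Δ.IsSymmetryOn Φ.toHomeo.source Set.univ fun q => ∑ k, c k • Ξ k q := by
  intro U₀ a b φ hφ t ht j _ hj hjp
  have hso := Φ.toHomeo.open_source
  have hle : ((1 : ℕ∞) : WithTop ℕ∞) ≤ ∞ := WithTop.coe_le_coe.2 le_top
  have hjs := hφ.subset hj
  have hφj : φ t j.1 ∈ Φ.toHomeo.source := hφ.mem t ht _ hj
  have hφc := hφ.contDiffAt ht hj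
  have hfreq : ∀ j ∈ Δ.variety Φ.toHomeo.source, ∃ᶠ j' in 𝓝 j,
      j' ∈ Δ.variety Φ.toHomeo.source ∧ ProlongableAt Φ.toHomeo j' := fun j hj =>
    mem_closure_iff_frequently.1 (hdense hj)
  constructor
  · intro hh
    have h1 : ∀ᶠ j' in 𝓝 j, j'.1 ∈ U₀ ∧ ProlongableAt (φ t) j' :=
      (continuousAt_fst.eventually_mem (hφ.isOpen.mem_nhds hj)).and
        (eventually_prolongableAt (hφc.of_le hle) hjp)
    have h2 : ∃ᶠ j' in 𝓝 j, Δ.HoldsAt (prolong (φ t) j') := by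
      refine ((hfreq j ⟨hjs, hh⟩).and_eventually h1).mono ?_
      rintro j' ⟨⟨hj', hjΦ'⟩, hj'U, hjp'⟩
      exact (hc U₀ a b φ hφ t ht j' (hR j' hj'.1 hjΦ') hj'U hjp').1 hj'.2
    exact Δ.holdsAt_of_frequently hso hΔ hφj
      ((continuousAt_prolong (hφc.of_le hle) hjp).frequently h2)
  · intro hh
    -- the local inverse of `φ t`
    set A := affineFlow (m := m) (fun i : Fin n => c i.castSucc) (c (Fin.last n)) with hA
    set ψ : Base n m → Base n m := fun q => Φ.toHomeo.symm (A (-t) (Φ.toHomeo q)) with hψ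
    have hΦφ : ∀ q ∈ U₀, Φ.toHomeo (φ t q) = A t (Φ.toHomeo q) := fun q hq =>
      hΦ.localFlow_eq hφ ht hq
    have hψφ : ∀ q ∈ U₀, ψ (φ t q) = q := by
      intro q hq
      simp only [hψ, hΦφ q hq]
      rw [hA, affineFlow_inverse, Φ.toHomeo.left_inv (hφ.subset hq)]
    have hAc : ContDiffAt ℝ ∞ (fun q => A (-t) (Φ.toHomeo q)) (φ t j.1) :=
      (contDiff_affineFlow_apply _ _ _).contDiffAt.comp _ (Φ.contDiffAt hφj)
    have hAt : A (-t) (Φ.toHomeo (φ t j.1)) ∈ Φ.toHomeo.target := by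
      rw [hΦφ _ hj, hA, affineFlow_inverse]
      exact Φ.toHomeo.map_source hjs
    have hψc : ContDiffAt ℝ ∞ ψ (φ t j.1) :=
      ContDiffAt.comp (φ t j.1) (g := Φ.toHomeo.symm) (f := fun q => A (-t) (Φ.toHomeo q))
        (Φ.contDiffAt_symm hAt) hAc
    have hφψ : ∀ᶠ q in 𝓝 (φ t j.1), φ t (ψ q) = q ∧ ψ q ∈ U₀ := by
      have h1 : ∀ᶠ q in 𝓝 (φ t j.1), ψ q ∈ U₀ := hψc.continuousAt.eventually_mem (by
        rw [hψφ _ hj]; exact hφ.isOpen.mem_nhds hj)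
      have h2 : ∀ᶠ q in 𝓝 (φ t j.1), A (-t) (Φ.toHomeo q) ∈ Φ.toHomeo.target :=
        hAc.continuousAt.eventually_mem (Φ.toHomeo.open_target.mem_nhds hAt)
      filter_upwards [h1, h2, hso.mem_nhds hφj] with q hq1 hq2 hq3
      refine ⟨Φ.toHomeo.injOn (hφ.mem t ht _ hq1) hq3 ?_, hq1⟩
      rw [hΦφ _ hq1, hψ, Φ.toHomeo.right_inv hq2, hA, affineFlow_inverse']
    obtain ⟨hψp, hψj⟩ := hjp.of_leftInverse (hφc.differentiableAt (by simp))
      (hψc.differentiableAt (by simp))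
      (by filter_upwards [hφ.isOpen.mem_nhds hj] with q hq using hψφ q hq)
    set j₁ := prolong (φ t) j
    have h1 : ∀ᶠ j' in 𝓝 j₁, (∀ᶠ q in 𝓝 j'.1, φ t (ψ q) = q ∧ ψ q ∈ U₀) ∧
        ProlongableAt ψ j' ∧ DifferentiableAt ℝ ψ j'.1 := by
      refine ((continuousAt_fst (p := j₁)).eventually
        (eventually_eventually_nhds.2 hφψ)).and
        ((eventually_prolongableAt (hψc.of_le hle) hψp).and ?_)
      have h3 : ∀ᶠ q in 𝓝 (φ t j.1), ContDiffAt ℝ 1 ψ q :=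
        (hψc.of_le hle).eventually (by simp)
      exact ((continuousAt_fst (p := j₁)).eventually h3).mono fun j' hj' =>
        hj'.differentiableAt one_ne_zero
    have h2 : ∃ᶠ j' in 𝓝 j₁, Δ.HoldsAt (prolong ψ j') := by
      refine ((hfreq j₁ ⟨hφj, hh⟩).and_eventually h1).mono ?_
      rintro j' ⟨⟨hj', hjΦ'⟩, hq, hψp', hψd'⟩
      have hU₀ : (prolong ψ j').1 ∈ U₀ := hq.self_of_nhds.2
      obtain ⟨h4, h5⟩ := hψp'.of_leftInverse hψd'
        ((hφ.contDiffAt ht hU₀).differentiableAt (by simp)) (hq.mono fun q hq => hq.1)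
      have h6 : ProlongableAt Φ.toHomeo (prolong ψ j') := by
        rw [← hΦ.prolongableAt_prolong_localFlow_iff hφ ht hU₀ h4, h5]
        exact hjΦ'
      refine (hc U₀ a b φ hφ t ht _ (hR _ (hφ.subset hU₀) h6) hU₀ h4).2 ?_
      rw [h5]
      exact hj'.2
    have h3 := (continuousAt_prolong (hψc.of_le hle) hψp).frequently h2
    rw [hψj] at h3
    exact Δ.holdsAt_of_frequently hso hΔ hjs h3

/-- The regular jets of the algebra of `Φ` are the jets at which `Φ` is prolongable. -/
lemma PointTransformation.mem_regularJets_canonicalFields_iff (Φ : PointTransformation n m)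
    {j : Jet n m} (hj : j.1 ∈ Φ.toHomeo.source) :
    j ∈ regularJets Φ.canonicalFields ↔ ProlongableAt Φ.toHomeo j :=
  Φ.straightens_canonicalFields.mem_regularJets_iff hj fun k =>
    ((Φ.contDiffOn_canonicalFields k).contDiffAt
      (Φ.toHomeo.open_source.mem_nhds hj)).differentiableAt (by simp)

/-- The algebra that a reduction yields. -/
theorem PolySystem.IsReducedBy.admitsAlgebra {Δ : PolySystem n m} {Φ : PointTransformation n m}
    (hΔ : Δ.IsReducedBy Φ) (hn : 0 < n) (hne : Φ.toHomeo.source.Nonempty) :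
    Δ.AdmitsAlgebra Φ.toHomeo.source (regularJets Φ.canonicalFields) Φ.canonicalFields := by
  have hS := Φ.straightens_canonicalFields
  refine ⟨hS.isReductionAlgebra hn hne Φ.contDiffOn_canonicalFields,
    hS.isSymmetryOn_of_isReducedBy hΔ fun j hj hjs =>
      (Φ.mem_regularJets_canonicalFields_iff hjs).1 hj, fun q hq => ?_⟩
  obtain ⟨p, hp, hp'⟩ := hΔ.2 q hq
  exact ⟨p, hp, (Φ.mem_regularJets_canonicalFields_iff (j := (q, p)) hq).2 hp'⟩

lemma PolySystem.IsSymmetryOn.mono {Δ : PolySystem n m} {U : Set (Base n m)}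
    {R R' : Set (Jet n m)} {Y : Base n m → Base n m} (h : Δ.IsSymmetryOn U R Y) (hR : R' ⊆ R) :
    Δ.IsSymmetryOn U R' Y := fun U₀ a b φ hφ t ht j hj => h U₀ a b φ hφ t ht j (hR hj)

lemma PolySystem.IsSmoothOn.mono {Δ : PolySystem n m} {U V : Set (Base n m)}
    (h : Δ.IsSmoothOn V) (hUV : U ⊆ V) : Δ.IsSmoothOn U := fun s =>
  IsSmoothFamily.mono (P := Δ s) (h s) hUV

end ReducedSystem

/-! ### The equivalence -/

theorem theorem1 {n m : ℕ} (hn : 0 < n) (Ω : Set (Base n m)) (hΩ : IsOpen Ω)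
    (Δ : PolySystem n m) (hΔ : Δ.IsSmoothOn Ω) (q₀ : Base n m) (hq₀ : q₀ ∈ Ω) :
    -- the equivalence, up to the jets where the new variables are singular
    ((∃ Φ : PointTransformation n m, q₀ ∈ Φ.toHomeo.source ∧ Φ.toHomeo.source ⊆ Ω ∧
        Δ.IsReducedBy Φ) ↔
      ∃ (U : Set (Base n m)) (Ξ : Fin (n + 1) → Base n m → Base n m),
        IsOpen U ∧ q₀ ∈ U ∧ U ⊆ Ω ∧ Δ.AdmitsAlgebra U (regularJets Ξ) Ξ) ∧
    -- the equivalence with symmetries on all jets, when the singular jets are negligible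
    ((∃ Φ : PointTransformation n m, q₀ ∈ Φ.toHomeo.source ∧ Φ.toHomeo.source ⊆ Ω ∧
        Δ.IsReducedBy Φ ∧
        Δ.variety Φ.toHomeo.source ⊆
          closure (Δ.variety Φ.toHomeo.source ∩ {j | ProlongableAt Φ.toHomeo j})) ↔
      ∃ (U : Set (Base n m)) (Ξ : Fin (n + 1) → Base n m → Base n m),
        IsOpen U ∧ q₀ ∈ U ∧ U ⊆ Ω ∧ Δ.AdmitsAlgebra U Set.univ Ξ ∧
        Δ.variety U ⊆ closure (Δ.variety U ∩ regularJets Ξ)) ∧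
    -- the reduction by canonical variables of a given algebra
    (∀ (U : Set (Base n m)) (Ξ : Fin (n + 1) → Base n m → Base n m),
      IsOpen U → q₀ ∈ U → U ⊆ Ω → Δ.AdmitsAlgebra U (regularJets Ξ) Ξ →
      ∃ Φ : PointTransformation n m, q₀ ∈ Φ.toHomeo.source ∧ Φ.toHomeo.source ⊆ U ∧
        Φ.Straightens Ξ ∧ Δ.IsReducedBy Φ) ∧
    -- the algebra that a given reduction yields
    (∀ Φ : PointTransformation n m, Φ.toHomeo.source ⊆ Ω → q₀ ∈ Φ.toHomeo.source →
      Δ.IsReducedBy Φ →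
      ∃ Ξ : Fin (n + 1) → Base n m → Base n m,
        Φ.Straightens Ξ ∧ Δ.AdmitsAlgebra Φ.toHomeo.source (regularJets Ξ) Ξ) := by
  have reduction : ∀ (U : Set (Base n m)) (Ξ : Fin (n + 1) → Base n m → Base n m),
      IsOpen U → q₀ ∈ U → U ⊆ Ω → Δ.AdmitsAlgebra U (regularJets Ξ) Ξ →
      ∃ Φ : PointTransformation n m, q₀ ∈ Φ.toHomeo.source ∧ Φ.toHomeo.source ⊆ U ∧
        Φ.Straightens Ξ ∧ Δ.IsReducedBy Φ := by
    intro U Ξ hU hq₀U hUΩ hA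
    obtain ⟨Φ, h1, h2, h3⟩ := hA.algebra.exists_straightens hU hq₀U
    exact hA.exists_isReducedBy hU (hΔ.mono hUΩ) h1 h2 h3
  refine ⟨⟨?_, ?_⟩, ⟨?_, ?_⟩, reduction, ?_⟩
  · rintro ⟨Φ, h1, h2, h3⟩
    exact ⟨Φ.toHomeo.source, Φ.canonicalFields, Φ.toHomeo.open_source, h1, h2,
      h3.admitsAlgebra hn ⟨q₀, h1⟩⟩
  · rintro ⟨U, Ξ, hU, h1, h2, h3⟩
    obtain ⟨Φ, h4, h5, -, h6⟩ := reduction U Ξ hU h1 h2 h3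
    exact ⟨Φ, h4, h5.trans h2, h6⟩
  · rintro ⟨Φ, h1, h2, h3, h4⟩
    have hA := h3.admitsAlgebra hn ⟨q₀, h1⟩
    have hreg : ∀ {j : Jet n m}, j.1 ∈ Φ.toHomeo.source →
        (j ∈ regularJets Φ.canonicalFields ↔ ProlongableAt Φ.toHomeo j) :=
      Φ.mem_regularJets_canonicalFields_iff
    refine ⟨Φ.toHomeo.source, Φ.canonicalFields, Φ.toHomeo.open_source, h1, h2,
      ⟨hA.algebra, fun c => ?_, hA.regular⟩, h4.trans (closure_mono ?_)⟩
    · exact Φ.straightens_canonicalFields.isSymmetryOn_univ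
        (fun j hj hjp => (hreg hj).2 hjp) (hΔ.mono h2) h4 (hA.symmetry c)
    · rintro j ⟨hj, hjp⟩
      exact ⟨hj, (hreg hj.1).2 hjp⟩
  · rintro ⟨U, Ξ, hU, h1, h2, h3, h4⟩
    obtain ⟨Φ, h5, h6, h7, h8⟩ := reduction U Ξ hU h1 h2
      ⟨h3.algebra, fun c => (h3.symmetry c).mono (Set.subset_univ _), h3.regular⟩
    refine ⟨Φ, h5, h6.trans h2, h8, fun j hj => ?_⟩
    have hev : ∀ᶠ j' : Jet n m in 𝓝 j, j'.1 ∈ Φ.toHomeo.source :=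
      continuousAt_fst.eventually_mem (Φ.toHomeo.open_source.mem_nhds hj.1)
    have hfreq := mem_closure_iff_frequently.1 (h4 ⟨h6 hj.1, hj.2⟩)
    refine mem_closure_iff_frequently.2 ((hfreq.and_eventually hev).mono ?_)
    rintro j' ⟨⟨hj', hreg⟩, hjs⟩
    refine ⟨⟨hjs, hj'.2⟩, (h7.mem_regularJets_iff hjs fun k => ?_).1 hreg⟩
    exact ((h3.algebra.smooth k).contDiffAt (hU.mem_nhds (h6 hjs))).differentiableAt (by simp)
  · intro Φ _ h1 h2
    exact ⟨Φ.canonicalFields, Φ.straightens_canonicalFields, h2.admitsAlgebra hn ⟨q₀, h1⟩⟩
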